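/- Let $\mathrm{Ai}(x)=\frac1{2\pi i}\int_{\mathrm{Re}\,\zeta=1}e^{\zeta^3/3-x\zeta}\,d\zeta$ be the Airy function and $H=-\frac{d^2}{du^2}+u$ the Airy Hamiltonian, with generalized eigenfunctions $\psi_E(u)=\mathrm{Ai}(u-E)$, $H\psi_E=E\psi_E$, $E\in\mathbb R$. A function $f(H)$ is given by the integral kernel $\langle x|f(H)|y\rangle=\int_{\mathbb R}f(E)\,\psi_E(x)\,\psi_E(y)\,dE$. Let $K$ be the operator with the Airy kernel $K(x,y)=\int_0^\infty \mathrm{Ai}(u+x)\,\mathrm{Ai}(u+y)\,du$; it is the spectral projection $\mathbf 1_{\{H<0\}}$, so that $$\langle x|e^{sH}K|y\rangle=\int_{-\infty}^0e^{sE}\psi_E(x)\psi_E(y)\,dE\ (s\ge0),\qquad \langle x|e^{sH}(1-K)|y\rangle=\int_0^{\infty}e^{sE}\psi_E(x)\psi_E(y)\,dE\ (s<0),$$ and $\langle x|e^{sH}|y\rangle=\int_{\mathbb R}e^{sE}\psi_E(x)\psi_E(y)\,dE$ for $s<0$. For $a\in\mathbb R$ let $\bar P_a$ be the projection of $L^2(\mathbb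 R)$ onto $L^2((-\infty,a])$. For an operator with real integral kernel $k$ on $L^2(X,\mu)$, the Fredholm determinant is $$\det(1-k)=\sum_{m\ge0}\frac{(-1)^m}{m!}\int_{X^m}\det\big(k(x_i,x_j)\big)_{i,j=1}^m\,d\mu(x_1)\cdots d\mu(x_m).$$ The series is said to converge absolutely if all these integrands are integrable and $\sum_m\frac1{m!}\int|\det(k(x_i,x_j))|\,d\mu^m<\infty$. Let $n\ge1$, $w_1<\dots<w_n$ and $a_1,\dots,a_n\in\mathbb R$. Let $\mathsf K$ be the $n\times n$ matrix of operators (the extended Airy kernel), acting on $L^2(\mathbb R)\otimes\mathbb C^n=L^2(\{1,\dots,n\}\times\mathbb R)$, with entries $$\langle x|\mathsf K_{ij}|y\rangle=\begin{cases}\mathbf 1_{\{x\ge a_i\}}\,\langle x|e^{(w_i-w_j)H}K|y\rangle\,\mathbf 1_{\{y\ge a_j\}}, & i\ge j,\\[2pt] -\mathbf 1_{\{x\ge a_i\}}\,\langle x|e^{(w_i-w_j)H}(1-K)|y\rangle\,\mathbf 1_{\{y\ge a_j\}}, & i<j.\end{cases}$$ Then $$\det(1-\mathsf K)=\det\Big(1-K+\bar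 P_{a_1}e^{(w_1-w_2)H}\bar P_{a_2}e^{(w_2-w_3)H}\cdots\bar P_{a_n}e^{(w_n-w_1)H}K\Big),$$ where the right-hand side is a Fredholm determinant on $L^2(\mathbb R)$, and the kernel of the operator product is the iterated integral of the kernels of its factors (the last two factors being taken together as $e^{(w_n-w_1)H}K$). Both sides are well defined: the integrals over $E$ above converge absolutely for all $x,y$, so do the integrals in the iterated product, and both Fredholm series converge absolutely. -/

import Mathlib

open MeasureTheory

noncomputable section

namespace AiryProc

/-! ## The Airy function -/

/-- The integrand `exp (ζ ^ 3 / 3 - x ζ)` of the contour integral of the Airy function, at the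
point `ζ = 1 + i s` of the vertical line `Re ζ = 1`. -/
def airyIntegrand (x s : ℝ) : ℂ :=
  Complex.exp ((1 + s * Complex.I) ^ 3 / 3 - x * (1 + s * Complex.I))

/-- The standard Airy function
`Ai x = (2 π i)⁻¹ ∫_{Re ζ = 1} exp (ζ ^ 3 / 3 - x ζ) dζ` (an absolutely convergent integral). -/
def Ai (x : ℝ) : ℝ := (2 * Real.pi)⁻¹ * (∫ s : ℝ, airyIntegrand x s).re

/-! ## The Airy Hamiltonian, its functional calculus and the Airy kernel -/

/-- The Airy Hamiltonian `H = - d²/du² + u` as a differential expression. -/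
def airyHamiltonian (φ : ℝ → ℝ) (u : ℝ) : ℝ := -deriv (deriv φ) u + u * φ u

/-- The generalized eigenfunction `u ↦ Ai (u - E)` of `H` with eigenvalue `E`; see
`airyHamiltonian_eigenfunction` below. -/
def eigenfunction (E u : ℝ) : ℝ := Ai (u - E)

/-- The integrand of the spectral decomposition of the kernel of `f(H)`. -/
def spectralIntegrand (f : ℝ → ℝ) (x y E : ℝ) : ℝ :=
  f E * (eigenfunction E x * eigenfunction E y)

/-- The integral kernel `⟨x| f(H) |y⟩ = ∫ f(E) ψ_E(x) ψ_E(y) dE` of the function `f(H)` of the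
Airy Hamiltonian, with `ψ_E` the normalized eigenfunction of energy `E`. -/
def spectralKernel (f : ℝ → ℝ) (x y : ℝ) : ℝ := ∫ E : ℝ, spectralIntegrand f x y E

/-- The Airy kernel `K(x,y) = ∫₀^∞ Ai (u + x) Ai (u + y) du`. -/
def airyKernel (x y : ℝ) : ℝ := ∫ u in Set.Ioi (0 : ℝ), Ai (u + x) * Ai (u + y)

/-- The function of the energy that gives `e^{sH}`. -/
def expSymbol (s E : ℝ) : ℝ := Real.exp (s * E)

/-- The function of the energy that gives `e^{sH} K`, where `K` is the spectral projection of `H`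
onto negative energies. -/
def expNegSymbol (s E : ℝ) : ℝ := if E < 0 then Real.exp (s * E) else 0

/-- The function of the energy that gives `e^{sH} (1 - K)`. -/
def expPosSymbol (s E : ℝ) : ℝ := if E < 0 then 0 else Real.exp (s * E)

/-- The kernel of `e^{sH}` (used for `s < 0`). -/
def expH (s : ℝ) : ℝ → ℝ → ℝ := spectralKernel (expSymbol s)

/-- The kernel of `e^{sH} K` (used for `0 ≤ s`). -/
def expHK (s : ℝ) : ℝ → ℝ → ℝ := spectralKernel (expNegSymbol s)

/-- The kernel of `e^{sH} (1 - K)` (used for `s < 0`). -/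
def expHOneSubK (s : ℝ) : ℝ → ℝ → ℝ := spectralKernel (expPosSymbol s)

/-! ## Fredholm determinants -/

/-- The integrand `det (k(x_i, x_j))_{i,j}` of the `m`-th term of the Fredholm series. -/
def fredholmMinor {α : Type*} (k : α → α → ℝ) (m : ℕ) (x : Fin m → α) : ℝ :=
  Matrix.det (Matrix.of fun i j : Fin m => k (x i) (x j))

/-- Absolute convergence of the Fredholm series of `det (1 - k)` on `L²(α, μ)`. -/
def FredholmConverges {α : Type*} [MeasurableSpace α] (μ : Measure α) (k : α → α → ℝ) : Prop :=
  (∀ m : ℕ, Integrable (fredholmMinor k m) (Measure.pi fun _ : Fin m => μ)) ∧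
  Summable fun m : ℕ =>
    (m.factorial : ℝ)⁻¹ * ∫ x, |fredholmMinor k m x| ∂(Measure.pi fun _ : Fin m => μ)

/-- The Fredholm determinant
`det (1 - k) = ∑_m (-1)^m / m! ∫ det (k(x_i, x_j)) dμ(x_1) … dμ(x_m)` on `L²(α, μ)` of the
operator with integral kernel `k`. -/
def fredholmDet {α : Type*} [MeasurableSpace α] (μ : Measure α) (k : α → α → ℝ) : ℝ :=
  ∑' m : ℕ, (-1 : ℝ) ^ m * (m.factorial : ℝ)⁻¹ *
    ∫ x, fredholmMinor k m x ∂(Measure.pi fun _ : Fin m => μ)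

/-! ## The matrix kernel -/

/-- The kernel `⟨x| 𝖪_ij |y⟩` of the entries of the extended Airy kernel. -/
def extendedEntry {n : ℕ} (w a : Fin n → ℝ) (i j : Fin n) (x y : ℝ) : ℝ :=
  if a i ≤ x ∧ a j ≤ y then
    if j ≤ i then expHK (w i - w j) x y else -expHOneSubK (w i - w j) x y
  else 0

/-- The `n × n` matrix of operators on `L²(ℝ)`, as one kernel on the index set `Fin n × ℝ` of
`L²(ℝ) ⊗ ℂⁿ`. -/
def extendedAiryKernel {n : ℕ} (w a : Fin n → ℝ) (p q : Fin n × ℝ) : ℝ :=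
  extendedEntry w a p.1 q.1 p.2 q.2

/-- The measure of `L²(ℝ) ⊗ ℂⁿ = L²({1, …, n} × ℝ)`. -/
def matrixMeasure (n : ℕ) : Measure (Fin n × ℝ) :=
  (Measure.count : Measure (Fin n)).prod volume

/-! ## The scalar kernel -/

/-- The kernel of the product of the operators with kernels `A` and `B`. -/
def kernelMul (A B : ℝ → ℝ → ℝ) (x y : ℝ) : ℝ := ∫ z : ℝ, A x z * B z y

/-- The kernel of `P̄_a R`, with `P̄_a` the projection onto `(-∞, a]`. -/
def barProj (a : ℝ) (R : ℝ → ℝ → ℝ) (x y : ℝ) : ℝ := if x ≤ a then R x y else 0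

/-- The kernel of
`P̄_{a₀} e^{(w₀ - w₁)H} P̄_{a₁} e^{(w₁ - w₂)H} ⋯ e^{(w_{m-1} - w_m)H} P̄_{a_m} R`. -/
def barChain (R : ℝ → ℝ → ℝ) :
    (m : ℕ) → (w a : Fin (m + 1) → ℝ) → ℝ → ℝ → ℝ
  | 0, _, a => barProj (a 0) R
  | m + 1, w, a =>
      barProj (a 0) (kernelMul (expH (w 0 - w 1)) (barChain R m (Fin.tail w) (Fin.tail a)))

/-- All the integrals in the iterated product `barChain` converge absolutely. -/
def BarChainConverges (R : ℝ → ℝ → ℝ) :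
    (m : ℕ) → (w a : Fin (m + 1) → ℝ) → Prop
  | 0, _, _ => True
  | m + 1, w, a =>
      (∀ x y : ℝ, Integrable fun z : ℝ =>
        expH (w 0 - w 1) x z * barChain R m (Fin.tail w) (Fin.tail a) z y) ∧
      BarChainConverges R m (Fin.tail w) (Fin.tail a)

/-- The kernel of
`K - P̄_{a_1} e^{(w_1 - w_2)H} P̄_{a_2} ⋯ P̄_{a_n} e^{(w_n - w_1)H} K`, where `n = m + 1` and the
points are numbered from `0` to `m`. -/
def scalarKernel {m : ℕ} (w a : Fin (m + 1) → ℝ) (x y : ℝ) : ℝ :=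
  airyKernel x y - barChain (expHK (w (Fin.last m) - w 0)) m w a x y

/-! ## Consistency of the definitions -/

/-- The Airy kernel is the spectral projection of `H` onto negative energies. -/
theorem airyKernel_eq_spectralKernel : airyKernel = spectralKernel (expNegSymbol 0) := by
  funext x y
  unfold airyKernel spectralKernel
  rw [← integral_indicator measurableSet_Ioi, ← integral_neg_eq_self]
  congr 1
  funext E
  unfold spectralIntegrand eigenfunction expNegSymbol
  by_cases h : E < 0
  · rw [Set.indicator_of_mem (by simpa using h), if_pos h]
    simp only [zero_mul, Real.exp_zero, one_mul, sub_eq_add_neg, add_comm]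
  · rw [Set.indicator_of_notMem (by simpa using h), if_neg h, zero_mul]

theorem norm_airyIntegrand (x s : ℝ) :
    ‖airyIntegrand x s‖ = Real.exp (1 / 3 - s ^ 2 - x) := by
  unfold airyIntegrand
  rw [Complex.norm_exp]
  congr 1
  have : ((1 + (s : ℂ) * Complex.I) ^ 3 / 3 - x * (1 + s * Complex.I))
      = ((1 / 3 - s ^ 2 - x : ℝ) : ℂ) + ((s - s ^ 3 / 3 - x * s : ℝ) : ℂ) * Complex.I := by
    have hI : Complex.I ^ 3 = -Complex.I := by
      rw [pow_succ, Complex.I_sq]; ring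
    push_cast
    ring_nf
    rw [hI, Complex.I_sq]
    ring
  rw [this, Complex.add_re, Complex.ofReal_re, Complex.re_ofReal_mul, Complex.I_re]
  ring

theorem norm_pow_mul_airyIntegrand_le (k : ℕ) (x₀ x s : ℝ) (hx : |x - x₀| < 1) :
    ‖(-(1 + (s : ℂ) * Complex.I)) ^ k * airyIntegrand x s‖ ≤
      Real.exp (4 / 3 + k ^ 2 / 2 - x₀) * Real.exp (-(1 / 2) * s ^ 2) := by
  rw [norm_mul, norm_pow, norm_neg, norm_airyIntegrand]
  have h1 : ‖1 + (s : ℂ) * Complex.I‖ ≤ Real.exp |s| := by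
    calc ‖1 + (s : ℂ) * Complex.I‖ ≤ ‖(1 : ℂ)‖ + ‖(s : ℂ) * Complex.I‖ := norm_add_le _ _
      _ = |s| + 1 := by simp [add_comm]
      _ ≤ Real.exp |s| := Real.add_one_le_exp _
  have h2 : ‖1 + (s : ℂ) * Complex.I‖ ^ k ≤ Real.exp (k * |s|) := by
    rw [Real.exp_nat_mul]
    exact pow_le_pow_left₀ (norm_nonneg _) h1 k
  calc _ ≤ Real.exp (k * |s|) * Real.exp (1 / 3 - s ^ 2 - x) := by gcongr
    _ = Real.exp (k * |s| + (1 / 3 - s ^ 2 - x)) := (Real.exp_add _ _).symm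
    _ ≤ Real.exp ((4 / 3 + k ^ 2 / 2 - x₀) + (-(1 / 2) * s ^ 2)) := by
        apply Real.exp_le_exp.2
        have := (abs_lt.1 hx).1
        nlinarith [sq_nonneg ((k : ℝ) - |s|), sq_abs s]
    _ = _ := Real.exp_add _ _

theorem continuous_pow_mul_airyIntegrand (k : ℕ) (x : ℝ) :
    Continuous fun s : ℝ => (-(1 + (s : ℂ) * Complex.I)) ^ k * airyIntegrand x s := by
  unfold airyIntegrand
  fun_prop

theorem integrable_airyBound (C : ℝ) :
    Integrable fun s : ℝ => C * Real.exp (-(1 / 2) * s ^ 2) :=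
  (integrable_exp_neg_mul_sq (by norm_num)).const_mul _

theorem integrable_pow_mul_airyIntegrand (k : ℕ) (x : ℝ) :
    Integrable fun s : ℝ => (-(1 + (s : ℂ) * Complex.I)) ^ k * airyIntegrand x s :=
  (integrable_airyBound (Real.exp (4 / 3 + k ^ 2 / 2 - x))).mono'
    (continuous_pow_mul_airyIntegrand k x).aestronglyMeasurable
    (ae_of_all _ fun s => norm_pow_mul_airyIntegrand_le k x x s (by simp))

theorem hasDerivAt_integral_airyIntegrand (k : ℕ) (x : ℝ) :
    HasDerivAt (fun x : ℝ => ∫ s : ℝ, (-(1 + (s : ℂ) * Complex.I)) ^ k * airyIntegrand x s)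
      (∫ s : ℝ, (-(1 + (s : ℂ) * Complex.I)) ^ (k + 1) * airyIntegrand x s) x := by
  refine (hasDerivAt_integral_of_dominated_loc_of_deriv_le
    (F := fun (x : ℝ) (s : ℝ) => (-(1 + (s : ℂ) * Complex.I)) ^ k * airyIntegrand x s)
    (F' := fun (x : ℝ) (s : ℝ) => (-(1 + (s : ℂ) * Complex.I)) ^ (k + 1) * airyIntegrand x s)
    (Metric.ball_mem_nhds x one_pos)
    (Filter.Eventually.of_forall fun y =>
      (continuous_pow_mul_airyIntegrand k y).aestronglyMeasurable)
    (integrable_pow_mul_airyIntegrand k x)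
    (continuous_pow_mul_airyIntegrand (k + 1) x).aestronglyMeasurable
    (ae_of_all _ fun s y hy => norm_pow_mul_airyIntegrand_le (k + 1) x y s
      (by simpa [Real.dist_eq] using hy))
    (integrable_airyBound _) (ae_of_all _ fun s y _ => ?_)).2
  have h : HasDerivAt (fun y : ℝ => (1 + (s : ℂ) * Complex.I) ^ 3 / 3
      - (y : ℂ) * (1 + s * Complex.I)) (-(1 * (1 + s * Complex.I))) y :=
    ((hasDerivAt_id y).ofReal_comp.mul_const _).const_sub _
  have h' := (h.cexp).const_mul ((-(1 + (s : ℂ) * Complex.I)) ^ k)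
  have e : (-(1 + (s : ℂ) * Complex.I)) ^ (k + 1) * airyIntegrand y s =
      (-(1 + (s : ℂ) * Complex.I)) ^ k * (Complex.exp ((1 + (s : ℂ) * Complex.I) ^ 3 / 3
        - (y : ℂ) * (1 + s * Complex.I)) * -(1 * (1 + s * Complex.I))) := by
    unfold airyIntegrand
    ring
  rw [e]
  exact h'

theorem hasDerivAt_re {f : ℝ → ℂ} {f' : ℂ} {x : ℝ} (h : HasDerivAt f f' x) :
    HasDerivAt (fun y => (f y).re) f'.re x :=
  (Complex.reCLM.hasFDerivAt.comp_hasDerivAt x h :)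

theorem hasDerivAt_Ai (x : ℝ) :
    HasDerivAt Ai ((2 * Real.pi)⁻¹ *
      (∫ s : ℝ, (-(1 + (s : ℂ) * Complex.I)) ^ 1 * airyIntegrand x s).re) x := by
  have h := (hasDerivAt_re (hasDerivAt_integral_airyIntegrand 0 x)).const_mul (2 * Real.pi)⁻¹
  simp only [pow_zero, one_mul, zero_add] at h
  exact h

theorem integral_airyIntegrand_sq (x : ℝ) :
    ∫ s : ℝ, (-(1 + (s : ℂ) * Complex.I)) ^ 2 * airyIntegrand x s =
      x * ∫ s : ℝ, airyIntegrand x s := by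
  have i0 : Integrable fun s : ℝ => airyIntegrand x s := by
    simpa using integrable_pow_mul_airyIntegrand 0 x
  have i2 := integrable_pow_mul_airyIntegrand 2 x
  have hd : ∀ s : ℝ, HasDerivAt (airyIntegrand x)
      (Complex.I * ((-(1 + (s : ℂ) * Complex.I)) ^ 2 * airyIntegrand x s
        - x * airyIntegrand x s)) s := by
    intro s
    have h1 : HasDerivAt (fun s : ℝ => 1 + (s : ℂ) * Complex.I) (1 * Complex.I) s :=
      ((hasDerivAt_id s).ofReal_comp.mul_const _).const_add _
    have h2 : HasDerivAt (airyIntegrand x) (airyIntegrand x s *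
        (((3 : ℕ) : ℂ) * (1 + (s : ℂ) * Complex.I) ^ (3 - 1) * (1 * Complex.I) / 3
          - x * (1 * Complex.I))) s :=
      (((h1.pow 3).div_const 3).sub (h1.const_mul (x : ℂ))).cexp
    convert h2 using 1
    push_cast
    ring
  have h0 := integral_eq_zero_of_hasDerivAt_of_integrable hd
    ((i2.sub (i0.const_mul (x : ℂ))).const_mul Complex.I) i0
  rw [integral_const_mul] at h0
  have h3 := (mul_eq_zero.1 h0).resolve_left Complex.I_ne_zero
  rw [integral_sub i2 (i0.const_mul (x : ℂ)), integral_const_mul] at h3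
  exact sub_eq_zero.1 h3

/-- The Airy equation `Ai'' = x Ai`. -/
theorem deriv_deriv_Ai (x : ℝ) : deriv (deriv Ai) x = x * Ai x := by
  have h : deriv Ai = fun x => (2 * Real.pi)⁻¹ *
      (∫ s : ℝ, (-(1 + (s : ℂ) * Complex.I)) ^ 1 * airyIntegrand x s).re :=
    funext fun x => (hasDerivAt_Ai x).deriv
  rw [h, ((hasDerivAt_re (hasDerivAt_integral_airyIntegrand 1 x)).const_mul
    (2 * Real.pi)⁻¹).deriv, integral_airyIntegrand_sq, Complex.re_ofReal_mul]
  unfold Ai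
  ring

/-- `u ↦ Ai (u - E)` is an eigenfunction of the Airy Hamiltonian with eigenvalue `E`. -/
theorem airyHamiltonian_eigenfunction (E u : ℝ) :
    airyHamiltonian (eigenfunction E) u = E * eigenfunction E u := by
  have h : deriv (eigenfunction E) = fun u => deriv Ai (u - E) :=
    funext fun u => deriv_comp_sub_const (f := Ai) E u
  have h2 : deriv (fun u => deriv Ai (u - E)) u = deriv (deriv Ai) (u - E) :=
    deriv_comp_sub_const (f := deriv Ai) E u
  unfold airyHamiltonian
  rw [h, h2, deriv_deriv_Ai]
  unfold eigenfunction
  ring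

end AiryProc

end

/-!
The proof multiplies `1 - 𝖪` from the right by two unipotent operators, which do not change its
Fredholm determinant, and arrives at a block triangular operator whose first diagonal block is
`1 - S`, where `S` is the scalar kernel, and whose other diagonal blocks are `1`.

Write `E_ij = e^{(w_i - w_j)H}`, `P_i = 1 - P̄_{a_i}`, and let `T` be the strictly upper triangular
matrix of the `E_ij`, `i < j`. Since `E_ij (1 - K) = E_ij - E_ij K`, the extended kernel is
`P (G - T) P` with `G_ij = E_ij K = (E_i0 K) E_0j`. As the rows of block `0` are supported on
`(a_0, ∞)`, the projection on the right may be dropped in column `0`, which turns block `0` into a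
whole line `L²(ℝ)`. Subtracting column `0` times `E_0j P_j` from the columns `j ≠ 0` removes `G`
from them (`blockKernel_shearedBlock_eq`); the entries of the kernel left there are
`P̄_0 E_0j P_j` in row `0` and `-P_i E_ij P_j` in the rows `i ≠ 0` with `i < j`. Let
`U_j = E_{j,j+1} P̄_{j+1} ⋯ P̄_m E_m0 K` for `j < m` and `U_m = E_m0 K`. Adding the columns `j ≠ 0`
times `P_j U_j` to column `0` clears it below the diagonal and turns its first entry into `1 - S`
(`eliminated_col_zero`). Both facts follow from `U_i + ∑_{j > i} E_ij P_j U_j = E_i0 K`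
(`chainTail_add_sum`), which is inclusion-exclusion together with the semigroup law.

At the level of Fredholm series, invariance under such a column operation is
`fredholmDet_column_operation`: the columns of `k` are changed one at a time, the new column is
expanded, the point of the expanded row is integrated out, and the resulting double series
telescopes. Absolute convergence comes from Hadamard's inequality, for kernels bounded by
`φ(p) ψ(q)` with `φ ψ` integrable.

The analytic input is elementary. Moving the contour of the Airy function to `Re ζ = r` gives
`|Ai x| ≤ C e^{-rx}` on the whole line for every `r > 0` (`exists_abs_Ai_le`). Fourier inversion
on the contour `Re ζ = t / 2` identifies the kernel of `e^{-tH}` with an explicit Gaussian kernel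
(`expH_eq_airyHeat`), and a Gaussian integral shows that it acts on the generalized eigenfunctions
by `e^{-tE}` (`integral_airyHeat_mul_eigenfunction`); this gives all the product formulas.
-/

noncomputable section

namespace AiryProc

/-! ### Hadamard's inequality -/

/-- Hadamard's inequality for entries bounded by one: AM-GM for the eigenvalues of `Mᵀ M`, whose
trace is at most `m ^ 2`. -/
theorem abs_det_le_of_abs_le_one {m : ℕ} (M : Matrix (Fin m) (Fin m) ℝ)
    (hM : ∀ i j, |M i j| ≤ 1) : |M.det| ≤ √((m : ℝ) ^ m) := by
  rcases Nat.eq_zero_or_pos m with rfl | hm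
  · simp
  have hm' : (0 : ℝ) < m := by exact_mod_cast hm
  have hP : (M.transpose * M).PosSemidef := by
    simpa using Matrix.posSemidef_conjTranspose_mul_self M
  have hH := hP.isHermitian
  have hdet : M.det ^ 2 = ∏ i, hH.eigenvalues i := by
    have := hH.det_eq_prod_eigenvalues
    rw [Matrix.det_mul, Matrix.det_transpose] at this
    simpa [sq] using this
  have htr : ∑ i, hH.eigenvalues i ≤ (m : ℝ) * m := by
    have h1 := hH.trace_eq_sum_eigenvalues
    have h2 : (M.transpose * M).trace ≤ (m : ℝ) * m := by
      simp only [Matrix.trace, Matrix.diag, Matrix.mul_apply, Matrix.transpose_apply]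
      calc ∑ i : Fin m, ∑ j : Fin m, M j i * M j i ≤ ∑ i : Fin m, ∑ j : Fin m, (1 : ℝ) := by
            refine Finset.sum_le_sum fun i _ => Finset.sum_le_sum fun j _ => ?_
            rw [← abs_mul_abs_self]
            exact mul_le_one₀ (hM j i) (abs_nonneg _) (hM j i)
        _ = (m : ℝ) * m := by simp
    rw [h1] at h2
    simpa using h2
  have hnn : ∀ i ∈ Finset.univ, 0 ≤ hH.eigenvalues i := fun i _ => hP.eigenvalues_nonneg i
  have amgm := Real.geom_mean_le_arith_mean Finset.univ (fun _ => (1 : ℝ)) hH.eigenvalues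
    (fun _ _ => zero_le_one) (by simpa using hm) hnn
  simp only [Real.rpow_one, Finset.sum_const, Finset.card_univ, Fintype.card_fin, nsmul_eq_mul,
    mul_one, one_mul] at amgm
  have h3 : ∏ i, hH.eigenvalues i ≤ (m : ℝ) ^ m := by
    have h4 : (∏ i, hH.eigenvalues i) ^ (m : ℝ)⁻¹ ≤ m :=
      amgm.trans ((div_le_iff₀ hm').2 htr)
    have h5 := pow_le_pow_left₀ (Real.rpow_nonneg (Finset.prod_nonneg hnn) _) h4 m
    rwa [Real.rpow_inv_natCast_pow (Finset.prod_nonneg hnn) hm.ne'] at h5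
  rw [← Real.sqrt_sq_eq_abs, hdet]
  exact Real.sqrt_le_sqrt h3

/-- Hadamard's inequality for a matrix whose entries are bounded by `α i * β j`. -/
theorem abs_det_le_of_abs_le_mul {m : ℕ} (M : Matrix (Fin m) (Fin m) ℝ) (α β : Fin m → ℝ)
    (hα : ∀ i, 0 ≤ α i) (hβ : ∀ i, 0 ≤ β i) (hM : ∀ i j, |M i j| ≤ α i * β j) :
    |M.det| ≤ √((m : ℝ) ^ m) * ∏ i, (α i * β i) := by
  have h1 : M = Matrix.of fun i j => α i * (Matrix.of fun i j => β j *
      (Matrix.of (fun i j => M i j / (α i * β j)) : Matrix (Fin m) (Fin m) ℝ) i j :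
        Matrix (Fin m) (Fin m) ℝ) i j := by
    ext i j
    simp only [Matrix.of_apply]
    by_cases h : α i * β j = 0
    · have := hM i j
      rw [h] at this
      rw [abs_nonpos_iff.1 this]
      simp
    · rw [← mul_assoc, mul_div_cancel₀ _ h]
  have h2 := abs_det_le_of_abs_le_one
    (Matrix.of (fun i j => M i j / (α i * β j)) : Matrix (Fin m) (Fin m) ℝ) (fun i j => by
      simp only [Matrix.of_apply]
      rw [abs_div, abs_of_nonneg (mul_nonneg (hα i) (hβ j))]
      exact div_le_one_of_le₀ (hM i j) (mul_nonneg (hα i) (hβ j)))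
  rw [h1, Matrix.det_mul_column, Matrix.det_mul_row, ← mul_assoc, ← Finset.prod_mul_distrib,
    abs_mul, abs_of_nonneg (Finset.prod_nonneg fun i _ => mul_nonneg (hα i) (hβ i)), mul_comm]
  exact mul_le_mul_of_nonneg_right h2 (Finset.prod_nonneg fun i _ => mul_nonneg (hα i) (hβ i))

/-- The majorant that Hadamard's inequality gives for a Fredholm series is summable. -/
theorem summable_hadamard (D : ℝ) (hD : 0 ≤ D) :
    Summable fun m : ℕ => (m.factorial : ℝ)⁻¹ * (√((m : ℝ) ^ m) * D ^ m) := by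
  have h1 : Summable fun m : ℕ =>
      ((1 / 4 : ℝ) ^ m + (4 * D ^ 2 * Real.exp 1) ^ m / m.factorial) / 2 :=
    ((summable_geometric_of_lt_one (by norm_num) (by norm_num)).add
      (Real.summable_pow_div_factorial _)).div_const 2
  refine h1.of_nonneg_of_le (fun m => by positivity) fun m => ?_
  have hf : (0 : ℝ) < m.factorial := by positivity
  have hs : √((m : ℝ) ^ m) ^ 2 = (m : ℝ) ^ m := Real.sq_sqrt (by positivity)
  have h2 : (m : ℝ) ^ m ≤ Real.exp 1 ^ m * m.factorial := by
    have := Real.pow_div_factorial_le_exp (x := m) (by positivity) m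
    rw [div_le_iff₀ hf] at this
    simpa [← Real.exp_nat_mul] using this
  set b : ℝ := (m.factorial : ℝ)⁻¹ * (√((m : ℝ) ^ m) * (2 * D) ^ m) with hb
  -- `2⁻ᵐ b ≤ (4⁻ᵐ + b²) / 2`, and `b²` is controlled by `mᵐ ≤ eᵐ m!`
  have h3 : b ^ 2 ≤ (4 * D ^ 2 * Real.exp 1) ^ m / m.factorial := by
    have : b ^ 2 = ((m : ℝ) ^ m * (4 * D ^ 2) ^ m) / (m.factorial : ℝ) ^ 2 := by
      rw [hb, mul_pow, mul_pow, hs, ← pow_mul, mul_comm m 2, pow_mul]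
      field_simp
      norm_num [mul_pow]
      exact mul_comm _ _
    rw [this, div_le_div_iff₀ (by positivity) hf, mul_pow (4 * D ^ 2)]
    calc _ = ((4 * D ^ 2) ^ m * m.factorial) * (m : ℝ) ^ m := by ring
      _ ≤ ((4 * D ^ 2) ^ m * m.factorial) * (Real.exp 1 ^ m * m.factorial) := by gcongr
      _ = _ := by ring
  have h4 : (m.factorial : ℝ)⁻¹ * (√((m : ℝ) ^ m) * D ^ m) = (1 / 2) ^ m * b := by
    rw [hb, mul_pow, show (1 / 2 : ℝ) ^ m = (2 ^ m)⁻¹ by simp]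
    field_simp
  have h5 : ((1 / 2 : ℝ) ^ m) ^ 2 = (1 / 4) ^ m := by
    rw [← pow_mul, mul_comm, pow_mul]; norm_num
  rw [h4]
  nlinarith [sq_nonneg ((1 / 2 : ℝ) ^ m - b)]

/-! ### Kernels dominated by a product of weights -/

/-- A pair of weights for kernels on `L²(α, μ)`: a kernel bounded by a multiple of `φ p * ψ q` has
an absolutely convergent Fredholm series because `φ * ψ` is integrable. -/
structure IsWeightPair {α : Type*} [MeasurableSpace α] (μ : Measure α) (φ ψ : α → ℝ) : Prop where
  nonneg_left : ∀ p, 0 ≤ φ p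
  nonneg_right : ∀ p, 0 ≤ ψ p
  integrable : Integrable (fun p => φ p * ψ p) μ

/-- The kernel `k` is measurable and bounded by `C φ(p) ψ(q)`. -/
structure IsDominated {α : Type*} [MeasurableSpace α] (φ ψ : α → ℝ) (C : ℝ) (k : α → α → ℝ) :
    Prop where
  measurable : Measurable (Function.uncurry k)
  bound : ∀ p q, |k p q| ≤ C * (φ p * ψ q)

/-- The kernel of the product of two integral operators on `L²(α, μ)`. -/
def opMul {α : Type*} [MeasurableSpace α] (μ : Measure α) (A B : α → α → ℝ) (x y : α) : ℝ :=
  ∫ z, A x z * B z y ∂μ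

section

variable {α : Type*} [MeasurableSpace α] {μ : Measure α} {φ ψ : α → ℝ} {C C' : ℝ}
  {k k' N : α → α → ℝ}

theorem IsDominated.mono (hw : IsWeightPair μ φ ψ) (hk : IsDominated φ ψ C k) (h : C ≤ C') :
    IsDominated φ ψ C' k :=
  ⟨hk.measurable, fun p q => (hk.bound p q).trans
    (mul_le_mul_of_nonneg_right h (mul_nonneg (hw.nonneg_left p) (hw.nonneg_right q)))⟩

theorem IsDominated.add (hk : IsDominated φ ψ C k) (hk' : IsDominated φ ψ C' k') :
    IsDominated φ ψ (C + C') (fun p q => k p q + k' p q) :=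
  ⟨hk.measurable.add hk'.measurable, fun p q => by
    rw [add_mul]
    exact (abs_add_le _ _).trans (add_le_add (hk.bound p q) (hk'.bound p q))⟩

theorem IsDominated.neg (hk : IsDominated φ ψ C k) : IsDominated φ ψ C (fun p q => -k p q) :=
  ⟨hk.measurable.neg, fun p q => by rw [abs_neg]; exact hk.bound p q⟩

theorem IsDominated.sub (hk : IsDominated φ ψ C k) (hk' : IsDominated φ ψ C' k') :
    IsDominated φ ψ (C + C') (fun p q => k p q - k' p q) := by
  simpa only [sub_eq_add_neg] using hk.add hk'.neg

theorem IsDominated.integrable_mul (hw : IsWeightPair μ φ ψ) (hk : IsDominated φ ψ C k)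
    (hN : IsDominated φ ψ C' N) (p q : α) : Integrable (fun z => k p z * N z q) μ := by
  refine (hw.integrable.const_mul (C * C' * (φ p * ψ q))).mono'
    ((hk.measurable.comp measurable_prodMk_left).mul
      (hN.measurable.comp measurable_prodMk_right)).aestronglyMeasurable (ae_of_all _ fun z => ?_)
  rw [Real.norm_eq_abs, abs_mul]
  calc |k p z| * |N z q| ≤ (C * (φ p * ψ z)) * (C' * (φ z * ψ q)) :=
        mul_le_mul (hk.bound p z) (hN.bound z q) (abs_nonneg _)
          ((abs_nonneg _).trans (hk.bound p z))
    _ = _ := by ring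

theorem IsDominated.opMul [SFinite μ] (hw : IsWeightPair μ φ ψ) (hk : IsDominated φ ψ C k)
    (hN : IsDominated φ ψ C' N) :
    IsDominated φ ψ (C * C' * ∫ z, φ z * ψ z ∂μ) (opMul μ k N) := by
  refine ⟨?_, fun p q => ?_⟩
  · have h : Measurable fun r : (α × α) × α => k r.1.1 r.2 * N r.2 r.1.2 :=
      (hk.measurable.comp (by fun_prop : Measurable fun r : (α × α) × α => (r.1.1, r.2))).mul
        (hN.measurable.comp (by fun_prop : Measurable fun r : (α × α) × α => (r.2, r.1.2)))
    exact (h.stronglyMeasurable.integral_prod_right (ν := μ)).measurable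
  · unfold AiryProc.opMul
    rw [← Real.norm_eq_abs]
    refine (norm_integral_le_of_norm_le (hw.integrable.const_mul (C * C' * (φ p * ψ q)))
      (ae_of_all _ fun z => ?_)).trans (le_of_eq ?_)
    · rw [Real.norm_eq_abs, abs_mul]
      calc |k p z| * |N z q| ≤ (C * (φ p * ψ z)) * (C' * (φ z * ψ q)) :=
            mul_le_mul (hk.bound p z) (hN.bound z q) (abs_nonneg _)
              ((abs_nonneg _).trans (hk.bound p z))
        _ = _ := by ring
    · rw [integral_const_mul]; ring

/-- Hadamard's inequality makes a determinant of dominated entries integrable over `αᵐ`. -/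
theorem integrable_det_of_bound [SigmaFinite μ] (hw : IsWeightPair μ φ ψ) {m : ℕ}
    (M : (Fin m → α) → Matrix (Fin m) (Fin m) ℝ) (hM : ∀ i j, Measurable fun x => M x i j)
    (hC : 0 ≤ C) (hb : ∀ x i j, |M x i j| ≤ C * (φ (x i) * ψ (x j))) :
    Integrable (fun x => (M x).det) (Measure.pi fun _ : Fin m => μ) ∧
    ∫ x, |(M x).det| ∂(Measure.pi fun _ : Fin m => μ) ≤
      √((m : ℝ) ^ m) * (C * ∫ z, φ z * ψ z ∂μ) ^ m := by
  have hbound : ∀ x, |(M x).det| ≤ √((m : ℝ) ^ m) * ∏ i, (C * (φ (x i) * ψ (x i))) := fun x => by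
    have := abs_det_le_of_abs_le_mul (M x) (fun i => C * φ (x i)) (fun j => ψ (x j))
      (fun i => mul_nonneg hC (hw.nonneg_left _)) (fun j => hw.nonneg_right _)
      (fun i j => by rw [mul_assoc]; exact hb x i j)
    simpa only [mul_assoc] using this
  have hmeas : Measurable fun x => (M x).det := by
    simp only [Matrix.det_apply]
    exact Finset.measurable_sum _ fun σ _ =>
      (Finset.measurable_prod _ fun i _ => hM _ _).const_smul _
  have hint : Integrable (fun x : Fin m → α => √((m : ℝ) ^ m) * ∏ i, (C * (φ (x i) * ψ (x i))))
      (Measure.pi fun _ : Fin m => μ) :=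
    (Integrable.fintype_prod (f := fun _ z => C * (φ z * ψ z))
      (fun _ => hw.integrable.const_mul C)).const_mul _
  have hi : Integrable (fun x => (M x).det) (Measure.pi fun _ : Fin m => μ) :=
    hint.mono' hmeas.aestronglyMeasurable (ae_of_all _ hbound)
  refine ⟨hi, (integral_mono hi.abs hint hbound).trans (le_of_eq ?_)⟩
  rw [integral_const_mul, integral_fintype_prod_eq_prod (fun _ z => C * (φ z * ψ z))]
  simp [integral_const_mul]

theorem IsDominated.integrable_fredholmMinor [SigmaFinite μ] (hw : IsWeightPair μ φ ψ) (hC : 0 ≤ C)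
    (hk : IsDominated φ ψ C k) (m : ℕ) :
    Integrable (fredholmMinor k m) (Measure.pi fun _ : Fin m => μ) ∧
    ∫ x, |fredholmMinor k m x| ∂(Measure.pi fun _ : Fin m => μ) ≤
      √((m : ℝ) ^ m) * (C * ∫ z, φ z * ψ z ∂μ) ^ m :=
  integrable_det_of_bound hw (fun x => Matrix.of fun i j : Fin m => k (x i) (x j))
    (fun i j => hk.measurable.comp (by fun_prop : Measurable fun x : Fin m → α => (x i, x j)))
    hC (fun x i j => hk.bound _ _)

theorem IsWeightPair.integral_nonneg (hw : IsWeightPair μ φ ψ) : 0 ≤ ∫ z, φ z * ψ z ∂μ :=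
  MeasureTheory.integral_nonneg fun z => mul_nonneg (hw.nonneg_left z) (hw.nonneg_right z)

theorem IsDominated.fredholmConverges [SigmaFinite μ] (hw : IsWeightPair μ φ ψ) (hC : 0 ≤ C)
    (hk : IsDominated φ ψ C k) : FredholmConverges μ k := by
  refine ⟨fun m => (hk.integrable_fredholmMinor hw hC m).1, ?_⟩
  refine (summable_hadamard _ (mul_nonneg hC hw.integral_nonneg)).of_nonneg_of_le
    (fun m => ?_) fun m => ?_
  · exact mul_nonneg (by positivity) (MeasureTheory.integral_nonneg fun x => abs_nonneg _)
  · exact mul_le_mul_of_nonneg_left (hk.integrable_fredholmMinor hw hC m).2 (by positivity)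

theorem FredholmConverges.summable (h : FredholmConverges μ k) :
    Summable fun m : ℕ => (-1 : ℝ) ^ m * (m.factorial : ℝ)⁻¹ *
      ∫ x, fredholmMinor k m x ∂(Measure.pi fun _ : Fin m => μ) := by
  refine Summable.of_norm_bounded h.2 fun m => ?_
  rw [norm_mul, norm_mul, norm_pow, norm_neg, norm_one, one_pow, one_mul, norm_inv,
    RCLike.norm_natCast]
  exact mul_le_mul_of_nonneg_left (norm_integral_le_integral_norm _) (by positivity)

end

/-! ### Column operations on Fredholm determinants -/

/-- Expansion along a column with a single nonzero entry, in an off-diagonal place `(i, l)`: after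
exchanging columns `i` and `l`, row and column `i` are deleted. -/
theorem det_updateCol_single_succAbove {m : ℕ} (A : Matrix (Fin (m + 1)) (Fin (m + 1)) ℝ)
    (i : Fin (m + 1)) (l : Fin m) (t : ℝ) :
    (A.updateCol (i.succAbove l) (Pi.single i t)).det =
      -(t * ((A.submatrix i.succAbove i.succAbove).updateCol l
        (fun r => A (i.succAbove r) i)).det) := by
  set B := A.updateCol (i.succAbove l) (Pi.single i t) with hB
  have hne : i ≠ i.succAbove l := (Fin.succAbove_ne i l).symm
  have h1 : (B.submatrix id (Equiv.swap i (i.succAbove l))).det = -B.det := by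
    rw [Matrix.det_permute', Equiv.Perm.sign_swap hne]; simp
  have h2 : (B.submatrix id (Equiv.swap i (i.succAbove l))).det =
      t * ((A.submatrix i.succAbove i.succAbove).updateCol l
        (fun r => A (i.succAbove r) i)).det := by
    rw [Matrix.det_succ_column _ i, Finset.sum_eq_single i]
    · rw [← two_mul, pow_mul]
      simp only [Matrix.submatrix_apply, id, Equiv.swap_apply_left, even_two, Even.neg_pow, one_pow,
        one_mul]
      rw [hB, Matrix.updateCol_self, Pi.single_eq_same]
      congr 2
      ext r j
      simp only [Matrix.submatrix_apply, id]
      by_cases hj : j = l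
      · subst hj
        simp
      · rw [Equiv.swap_apply_of_ne_of_ne (Fin.succAbove_ne i j)
          (fun h => hj (Fin.succAbove_right_injective h)), Matrix.updateCol_ne hj,
          Matrix.updateCol_ne (fun h => hj (Fin.succAbove_right_injective h))]
        rfl
    · intro r _ hr
      simp only [Matrix.submatrix_apply, id, Equiv.swap_apply_left]
      rw [hB, Matrix.updateCol_self, Pi.single_eq_of_ne hr]
      simp
    · simp
  rw [← h2, h1, neg_neg]

/-- The matrix of the points `x` whose column `j` is taken from `k'` for `j < l` and from `k` for
`j ≥ l`. -/
def mixedMatrix {β : Type*} (k' k : β → β → ℝ) {m : ℕ} (l : ℕ) (x : Fin m → β) :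
    Matrix (Fin m) (Fin m) ℝ :=
  Matrix.of fun i j => if (j : ℕ) < l then k' (x i) (x j) else k (x i) (x j)

/-- The minor of `mixedMatrix` with column `l` replaced by the one of the kernel `N`. -/
def mixedMinor {β : Type*} (k' k N : β → β → ℝ) {m : ℕ} (l : Fin m) (x : Fin m → β) : ℝ :=
  ((mixedMatrix k' k l x).updateCol l fun i => N (x i) (x l)).det

theorem fredholmMinor_sub_eq_sum {β : Type*} {k k' : β → β → ℝ} (m : ℕ)
    (x : Fin m → β) (D : β → β → ℝ)
    (hD : ∀ p q, k' p q = k p q + D p q) :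
    fredholmMinor k' m x - fredholmMinor k m x = ∑ l : Fin m, mixedMinor k' k D l x := by
  have h1 : ∀ l : Fin m, mixedMinor k' k D l x =
      (mixedMatrix k' k (l + 1) x).det - (mixedMatrix k' k l x).det := by
    intro l
    have e1 : mixedMatrix k' k (l + 1) x = (mixedMatrix k' k l x).updateCol l
        ((fun i => k (x i) (x l)) + fun i => D (x i) (x l)) := by
      ext i j
      by_cases hj : j = l
      · subst hj
        simp [mixedMatrix, hD]
      · have : ((j : ℕ) < l + 1) ↔ ((j : ℕ) < l) := by
          have := Fin.val_ne_of_ne hj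
          omega
        simp only [mixedMatrix, Matrix.of_apply, Matrix.updateCol_ne hj, this]
    have e2 : mixedMatrix k' k l x = (mixedMatrix k' k l x).updateCol l
        (fun i => k (x i) (x l)) := by
      ext i j
      by_cases hj : j = l
      · subst hj
        simp [mixedMatrix]
      · simp [Matrix.updateCol_ne hj]
    rw [e1, Matrix.det_updateCol_add, ← e2]
    unfold mixedMinor
    ring
  simp only [h1]
  rw [Fin.sum_univ_eq_sum_range (fun l => (mixedMatrix k' k (l + 1) x).det -
    (mixedMatrix k' k l x).det) m, Finset.sum_range_sub (fun l => (mixedMatrix k' k l x).det)]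
  congr 1
  unfold fredholmMinor mixedMatrix
  simp

section

variable {α : Type*} [MeasurableSpace α] {μ : Measure α} {φ ψ : α → ℝ} {C C' : ℝ}
  {k k' N : α → α → ℝ}

theorem measurable_mixedMatrix (hk : Measurable (Function.uncurry k))
    (hk' : Measurable (Function.uncurry k')) {m : ℕ} (l : ℕ) (i j : Fin m) :
    Measurable fun x => mixedMatrix k' k l x i j := by
  unfold mixedMatrix
  simp only [Matrix.of_apply]
  split_ifs
  · exact hk'.comp (by fun_prop : Measurable fun x : Fin m → α => (x i, x j))
  · exact hk.comp (by fun_prop : Measurable fun x : Fin m → α => (x i, x j))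

theorem integrable_mixedMinor [SigmaFinite μ] (hw : IsWeightPair μ φ ψ) (hC : 0 ≤ C)
    (hk : IsDominated φ ψ C k) (hk' : IsDominated φ ψ C k') (hN : IsDominated φ ψ C N)
    {m : ℕ} (l : Fin m) :
    Integrable (mixedMinor k' k N l) (Measure.pi fun _ : Fin m => μ) ∧
    ∫ x, |mixedMinor k' k N l x| ∂(Measure.pi fun _ : Fin m => μ) ≤
      √((m : ℝ) ^ m) * (C * ∫ z, φ z * ψ z ∂μ) ^ m := by
  refine integrable_det_of_bound hw
    (fun x => (mixedMatrix k' k l x).updateCol l fun i => N (x i) (x l)) (fun i j => ?_) hC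
    (fun x i j => ?_)
  · by_cases hj : j = l
    · subst hj
      simp only [Matrix.updateCol_self]
      exact hN.measurable.comp (by fun_prop : Measurable fun x : Fin m → α => (x i, x j))
    · simp only [Matrix.updateCol_ne hj]
      exact measurable_mixedMatrix hk.measurable hk'.measurable _ _ _
  · by_cases hj : j = l
    · subst hj
      simp only [Matrix.updateCol_self]
      exact hN.bound _ _
    · simp only [Matrix.updateCol_ne hj]
      unfold mixedMatrix
      simp only [Matrix.of_apply]
      split_ifs
      · exact hk'.bound _ _
      · exact hk.bound _ _

end

theorem det_updateCol_eq_sum {m : ℕ} (A : Matrix (Fin m) (Fin m) ℝ) (l : Fin m) (v : Fin m → ℝ) :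
    (A.updateCol l v).det = ∑ i, A.adjugate l i * v i := by
  rw [← Matrix.cramer_apply, Matrix.cramer_eq_adjugate_mulVec]
  rfl

theorem det_updateCol_eq_sum_single {m : ℕ} (A : Matrix (Fin m) (Fin m) ℝ) (l : Fin m)
    (v : Fin m → ℝ) :
    (A.updateCol l v).det = ∑ i, (A.updateCol l (Pi.single i (v i))).det := by
  simp [det_updateCol_eq_sum, Pi.single_apply]

theorem integral_mul_det_updateCol {α : Type*} [MeasurableSpace α] {μ : Measure α} {m : ℕ}
    (A : Matrix (Fin m) (Fin m) ℝ) (l : Fin m) (f : Fin m → α → ℝ) (c : α → ℝ)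
    (hf : ∀ r, Integrable (fun z => f r z * c z) μ) :
    ∫ z, c z * (A.updateCol l fun r => f r z).det ∂μ =
      (A.updateCol l fun r => ∫ z, f r z * c z ∂μ).det := by
  simp only [det_updateCol_eq_sum, Finset.mul_sum]
  rw [integral_finsetSum _ fun r _ => ?_]
  · refine Finset.sum_congr rfl fun r _ => ?_
    rw [← integral_const_mul]
    congr 1
    funext z
    ring
  · exact ((hf r).const_mul (A.adjugate l r)).congr (ae_of_all _ fun z => by ring)

section

variable {α : Type*} {Y : Set α} {k k' N : α → α → ℝ}

theorem sum_mixedMinor_succ (hN : ∀ p q, N p q ≠ 0 → p ∈ Y ∧ q ∉ Y) {m : ℕ} (x : Fin (m + 1) → α) :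
    ∑ l, mixedMinor k' k N l x = ∑ i : Fin (m + 1), ∑ l : Fin m,
      ((mixedMatrix k' k (i.succAbove l) x).updateCol (i.succAbove l)
        (Pi.single i (N (x i) (x (i.succAbove l))))).det := by
  unfold mixedMinor
  simp_rw [fun l : Fin (m + 1) => det_updateCol_eq_sum_single (mixedMatrix k' k (l : ℕ) x) l
    (fun i => N (x i) (x l))]
  rw [Finset.sum_comm]
  refine Finset.sum_congr rfl fun i _ => ?_
  rw [Fin.sum_univ_succAbove _ i]
  have h0 : N (x i) (x i) = 0 := by
    by_contra h
    exact (hN _ _ h).2 (hN _ _ h).1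
  rw [h0, Pi.single_zero, Matrix.det_eq_zero_of_column_eq_zero i (fun r => by simp), zero_add]

/-- The entry in row `i` of the column of `N` vanishes unless the point `x i` lies in `Y`, where `k`
and `k'` have the same columns; so it does not matter which kernel fills column `i`. -/
theorem det_mixedMatrix_updateCol_single (hN : ∀ p q, N p q ≠ 0 → p ∈ Y ∧ q ∉ Y)
    (hkk' : ∀ p, ∀ q ∈ Y, k' p q = k p q) {m : ℕ} (x : Fin (m + 1) → α) (i : Fin (m + 1))
    (l : Fin m) :
    ((mixedMatrix k' k (i.succAbove l) x).updateCol (i.succAbove l)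
        (Pi.single i (N (x i) (x (i.succAbove l))))).det =
      -(N (x i) (x (i.succAbove l)) * ((mixedMatrix k' k l fun j => x (i.succAbove j)).updateCol l
        fun r => k (x (i.succAbove r)) (x i)).det) := by
  rw [det_updateCol_single_succAbove]
  by_cases h : N (x i) (x (i.succAbove l)) = 0
  · rw [h, zero_mul, zero_mul]
  congr 3
  ext r j
  by_cases hj : j = l
  · subst hj
    simp only [Matrix.updateCol_self, mixedMatrix, Matrix.of_apply]
    rw [hkk' _ _ (hN _ _ h).1, ite_self]
  · simp only [Matrix.updateCol_ne hj, mixedMatrix, Matrix.of_apply, Matrix.submatrix_apply]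
    have : ((i.succAbove j : Fin (m + 1)) : ℕ) < (i.succAbove l : Fin (m + 1)) ↔ (j : ℕ) < l :=
      (Fin.strictMono_succAbove i).lt_iff_lt
    simp only [this]

end

section

variable {α : Type*} [MeasurableSpace α] {μ : Measure α} {φ ψ : α → ℝ} {C : ℝ} {Y : Set α}
  {k k' N : α → α → ℝ}

/-- Integrating out the point of the expanded row turns the column of `N` on `m + 1` points into
the column of the product kernel `k N` on `m` points. -/
theorem integral_sum_mixedMinor_succ [SigmaFinite μ] (hw : IsWeightPair μ φ ψ) (hC : 0 ≤ C)
    (hk : IsDominated φ ψ C k) (hk' : IsDominated φ ψ C k') (hND : IsDominated φ ψ C N)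
    (hN : ∀ p q, N p q ≠ 0 → p ∈ Y ∧ q ∉ Y) (hkk' : ∀ p, ∀ q ∈ Y, k' p q = k p q) (m : ℕ) :
    ∫ x, ∑ l, mixedMinor k' k N l x ∂(Measure.pi fun _ : Fin (m + 1) => μ) =
      -((m + 1 : ℝ) * ∑ l : Fin m,
        ∫ x, mixedMinor k' k (opMul μ k N) l x ∂(Measure.pi fun _ : Fin m => μ)) := by
  set F : Fin (m + 1) → Fin m → (Fin (m + 1) → α) → ℝ := fun i l x =>
    ((mixedMatrix k' k (i.succAbove l) x).updateCol (i.succAbove l)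
        (Pi.single i (N (x i) (x (i.succAbove l))))).det with hF
  have hFi : ∀ i l, Integrable (F i l) (Measure.pi fun _ : Fin (m + 1) => μ) := fun i l => by
    refine (integrable_det_of_bound hw
      (fun x => (mixedMatrix k' k (i.succAbove l) x).updateCol (i.succAbove l)
        (Pi.single i (N (x i) (x (i.succAbove l))))) (fun r j => ?_) hC (fun x r j => ?_)).1
    · by_cases hj : j = i.succAbove l
      · subst hj
        simp only [Matrix.updateCol_self]
        by_cases hr : r = i
        · subst hr
          simp only [Pi.single_eq_same]
          exact hND.measurable.comp
            (by fun_prop : Measurable fun x : Fin (m + 1) → α => (x r, x (r.succAbove l)))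
        · simp only [Pi.single_eq_of_ne hr]
          exact measurable_const
      · simp only [Matrix.updateCol_ne hj]
        exact measurable_mixedMatrix hk.measurable hk'.measurable _ _ _
    · have h0 : 0 ≤ C * (φ (x r) * ψ (x j)) :=
        mul_nonneg hC (mul_nonneg (hw.nonneg_left _) (hw.nonneg_right _))
      by_cases hj : j = i.succAbove l
      · subst hj
        simp only [Matrix.updateCol_self]
        by_cases hr : r = i
        · subst hr
          simp only [Pi.single_eq_same]
          exact hND.bound _ _
        · simp only [Pi.single_eq_of_ne hr, abs_zero]
          exact h0
      · simp only [Matrix.updateCol_ne hj, mixedMatrix, Matrix.of_apply]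
        split_ifs
        · exact hk'.bound _ _
        · exact hk.bound _ _
  have hint : ∀ i l, ∫ x, F i l x ∂(Measure.pi fun _ : Fin (m + 1) => μ) =
      -∫ x, mixedMinor k' k (opMul μ k N) l x ∂(Measure.pi fun _ : Fin m => μ) := by
    intro i l
    have hmp := measurePreserving_piFinSuccAbove (fun _ : Fin (m + 1) => μ) i
    set e := MeasurableEquiv.piFinSuccAbove (fun _ : Fin (m + 1) => α) i with he
    set h : α × (Fin m → α) → ℝ := fun zy => -(N zy.1 (zy.2 l) *
      ((mixedMatrix k' k l zy.2).updateCol l fun r => k (zy.2 r) zy.1).det) with hh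
    have hFh : F i l = fun x => h (e x) := by
      funext x
      simp only [hF, hh]
      rw [det_mixedMatrix_updateCol_single hN hkk']
      rfl
    have hi : Integrable h (μ.prod (Measure.pi fun _ : Fin m => μ)) := by
      rw [← hmp.integrable_comp_emb e.measurableEmbedding]
      have := hFi i l
      rw [hFh] at this
      exact this
    rw [hFh, hmp.integral_comp' h, integral_prod_symm _ hi, ← integral_neg]
    congr 1
    funext y
    simp only [hh]
    rw [integral_neg, integral_mul_det_updateCol _ _ _ _
      (fun r => hk.integrable_mul hw hND (y r) (y l))]
    rfl
  simp_rw [sum_mixedMinor_succ hN]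
  rw [integral_finsetSum _ fun i _ => integrable_finsetSum _ fun l _ => hFi i l]
  simp_rw [integral_finsetSum _ fun l _ => hFi _ l]
  simp only [hint, Finset.sum_neg_distrib, Finset.sum_const, Finset.card_univ, Fintype.card_fin,
    nsmul_eq_mul]
  push_cast
  rfl

/-- **Invariance under column operations.** If `N` maps functions on the complement of `Y` to
functions on `Y`, then `1 + N` is unipotent and `det ((1 - k) (1 + N)) = det (1 - k)`. The
difference of the two series telescopes. -/
theorem fredholmDet_column_operation [SigmaFinite μ] (hw : IsWeightPair μ φ ψ)
    (hk : IsDominated φ ψ C k) (hND : IsDominated φ ψ C N)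
    (hN : ∀ p q, N p q ≠ 0 → p ∈ Y ∧ q ∉ Y) :
    fredholmDet μ (fun p q => k p q - N p q + opMul μ k N p q) = fredholmDet μ k := by
  -- a common constant for all the kernels
  obtain ⟨D, hD, hkD, hND, hkN, hk'⟩ : ∃ D, 0 ≤ D ∧ IsDominated φ ψ D k ∧ IsDominated φ ψ D N ∧
      IsDominated φ ψ D (opMul μ k N) ∧
      IsDominated φ ψ D (fun p q => k p q - N p q + opMul μ k N p q) := by
    have h1 := hk.opMul hw hND
    have h2 := (hk.sub hND).add h1
    refine ⟨|C| + |C * C * ∫ z, φ z * ψ z ∂μ| + |C + C + C * C * ∫ z, φ z * ψ z ∂μ|,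
      by positivity, hk.mono hw ?_, hND.mono hw ?_, h1.mono hw ?_, h2.mono hw ?_⟩
    · linarith [le_abs_self C, abs_nonneg (C * C * ∫ z, φ z * ψ z ∂μ),
        abs_nonneg (C + C + C * C * ∫ z, φ z * ψ z ∂μ)]
    · linarith [le_abs_self C, abs_nonneg (C * C * ∫ z, φ z * ψ z ∂μ),
        abs_nonneg (C + C + C * C * ∫ z, φ z * ψ z ∂μ)]
    · linarith [abs_nonneg C, le_abs_self (C * C * ∫ z, φ z * ψ z ∂μ),
        abs_nonneg (C + C + C * C * ∫ z, φ z * ψ z ∂μ)]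
    · linarith [abs_nonneg C, abs_nonneg (C * C * ∫ z, φ z * ψ z ∂μ),
        le_abs_self (C + C + C * C * ∫ z, φ z * ψ z ∂μ)]
  set k' : α → α → ℝ := fun p q => k p q - N p q + opMul μ k N p q with hk'def
  have hkk' : ∀ p, ∀ q ∈ Y, k' p q = k p q := by
    intro p q hq
    have h0 : ∀ z, N z q = 0 := fun z => by
      by_contra h
      exact (hN _ _ h).2 hq
    simp [hk'def, h0, opMul]
  set I : ℝ := ∫ z, φ z * ψ z ∂μ with hI
  have hI0 : 0 ≤ I := hw.integral_nonneg
  set A : ℕ → ℝ := fun m => ∑ l : Fin m,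
    ∫ x, mixedMinor k' k N l x ∂(Measure.pi fun _ : Fin m => μ) with hA
  set B : ℕ → ℝ := fun m => ∑ l : Fin m,
    ∫ x, mixedMinor k' k (opMul μ k N) l x ∂(Measure.pi fun _ : Fin m => μ) with hB
  have hAB : ∀ m, A (m + 1) = -((m + 1 : ℝ) * B m) := fun m => by
    rw [← integral_sum_mixedMinor_succ hw hD hkD hk' hND hN hkk' m,
      integral_finsetSum _ fun l _ => (integrable_mixedMinor hw hD hkD hk' hND l).1]
  have hdiff : ∀ m, (∫ x, fredholmMinor k' m x ∂(Measure.pi fun _ : Fin m => μ)) -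
      ∫ x, fredholmMinor k m x ∂(Measure.pi fun _ : Fin m => μ) = B m - A m := by
    intro m
    rw [← integral_sub (hk'.integrable_fredholmMinor hw hD m).1
      (hkD.integrable_fredholmMinor hw hD m).1]
    have h1 : ∀ x : Fin m → α, fredholmMinor k' m x - fredholmMinor k m x =
        ∑ l, (mixedMinor k' k (opMul μ k N) l x - mixedMinor k' k N l x) := by
      intro x
      rw [fredholmMinor_sub_eq_sum m x (fun p q => opMul μ k N p q - N p q)
        (fun p q => by simp only [hk'def]; ring)]
      refine Finset.sum_congr rfl fun l _ => ?_
      unfold mixedMinor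
      simp only [det_updateCol_eq_sum, mul_sub, Finset.sum_sub_distrib]
    simp_rw [h1]
    rw [integral_finsetSum (f := fun l x => mixedMinor k' k (opMul μ k N) l x -
      mixedMinor k' k N l x) _ fun l _ => (integrable_mixedMinor hw hD hkD hk' hkN l).1.sub
        (integrable_mixedMinor hw hD hkD hk' hND l).1]
    simp_rw [fun l => integral_sub (integrable_mixedMinor hw hD hkD hk' hkN l).1
      (integrable_mixedMinor hw hD hkD hk' hND l).1]
    rw [Finset.sum_sub_distrib]
  have hBs : Summable fun m : ℕ => (-1 : ℝ) ^ m * (m.factorial : ℝ)⁻¹ * B m := by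
    refine Summable.of_norm_bounded (summable_hadamard (2 * (D * I)) (by positivity)) fun m => ?_
    rw [norm_mul, norm_mul, norm_pow, norm_neg, norm_one, one_pow, one_mul, norm_inv,
      RCLike.norm_natCast]
    refine mul_le_mul_of_nonneg_left ?_ (by positivity)
    calc ‖B m‖ ≤ ∑ l : Fin m, √((m : ℝ) ^ m) * (D * I) ^ m :=
          norm_sum_le_of_le _ fun l _ => (norm_integral_le_integral_norm _).trans
            (integrable_mixedMinor hw hD hkD hk' hkN l).2
      _ = (m : ℝ) * (√((m : ℝ) ^ m) * (D * I) ^ m) := by simp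
      _ ≤ (2 : ℝ) ^ m * (√((m : ℝ) ^ m) * (D * I) ^ m) := by
          gcongr
          exact_mod_cast (Nat.lt_two_pow_self (n := m)).le
      _ = _ := by rw [mul_pow 2]; ring
  have hS' := (hk'.fredholmConverges hw hD).summable
  have hS := (hkD.fredholmConverges hw hD).summable
  have hAeq : ∀ m : ℕ, (-1 : ℝ) ^ (m + 1) * ((m + 1).factorial : ℝ)⁻¹ * A (m + 1) =
      (-1 : ℝ) ^ m * (m.factorial : ℝ)⁻¹ * B m := by
    intro m
    rw [hAB, Nat.factorial_succ]
    push_cast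
    field_simp
    ring
  have hA0 : A 0 = 0 := by simp [hA]
  have hAs : Summable fun m : ℕ => (-1 : ℝ) ^ m * (m.factorial : ℝ)⁻¹ * A m := by
    rw [← summable_nat_add_iff 1]
    exact hBs.congr fun m => (hAeq m).symm
  rw [← sub_eq_zero]
  unfold fredholmDet
  rw [← hS'.tsum_sub hS]
  have h2 : ∀ m : ℕ, ((-1 : ℝ) ^ m * (m.factorial : ℝ)⁻¹ *
        ∫ x, fredholmMinor k' m x ∂(Measure.pi fun _ : Fin m => μ)) -
      (-1 : ℝ) ^ m * (m.factorial : ℝ)⁻¹ *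
        ∫ x, fredholmMinor k m x ∂(Measure.pi fun _ : Fin m => μ) =
      (-1 : ℝ) ^ m * (m.factorial : ℝ)⁻¹ * B m - (-1 : ℝ) ^ m * (m.factorial : ℝ)⁻¹ * A m := by
    intro m
    rw [← mul_sub, hdiff, mul_sub]
  simp_rw [h2]
  rw [hBs.tsum_sub hAs, hAs.tsum_eq_zero_add, hA0, mul_zero, zero_add]
  simp_rw [hAeq]
  exact sub_self _

/-! ### Supports of the rows of a kernel -/

theorem fredholmMinor_eq_zero_of_row {β : Type*} {k : β → β → ℝ} {m : ℕ} {x : Fin m → β} (i : Fin m)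
    (h : ∀ j, k (x i) (x j) = 0) : fredholmMinor k m x = 0 :=
  Matrix.det_eq_zero_of_row_eq_zero i h

/-- The Fredholm determinant depends only on the restriction of the kernel to a set that supports
the rows, and not on a null set. -/
theorem fredholmDet_congr_of_rows [SigmaFinite μ] (Z Y : Set α) (hZ : μ Z = 0)
    (hk : ∀ p ∉ Z, p ∉ Y → ∀ q ∉ Z, k p q = 0) (hk' : ∀ p ∉ Z, p ∉ Y → ∀ q ∉ Z, k' p q = 0)
    (h : ∀ p ∉ Z, ∀ q ∉ Z, p ∈ Y → q ∈ Y → k p q = k' p q) :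
    fredholmDet μ k = fredholmDet μ k' := by
  unfold fredholmDet
  congr 1
  funext m
  congr 1
  have hZ' : ∀ᵐ p ∂μ, p ∉ Z := by
    rw [ae_iff]
    simpa using hZ
  have hae : ∀ᵐ x ∂(Measure.pi fun _ : Fin m => μ), ∀ i, x i ∉ Z :=
    ae_all_iff.2 fun i => (Measure.quasiMeasurePreserving_eval (fun _ : Fin m => μ) i).ae hZ'
  refine integral_congr_ae ?_
  filter_upwards [hae] with x hx
  by_cases hY : ∀ i, x i ∈ Y
  · unfold fredholmMinor
    congr 2
    ext i j
    exact h _ (hx i) _ (hx j) (hY i) (hY j)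
  · push Not at hY
    obtain ⟨i, hi⟩ := hY
    rw [fredholmMinor_eq_zero_of_row i fun j => hk _ (hx i) hi _ (hx j),
      fredholmMinor_eq_zero_of_row i fun j => hk' _ (hx i) hi _ (hx j)]

/-- If all minors with a point outside the range of `e` vanish, then the Fredholm determinant is
that of the kernel pulled back along `e`. -/
theorem fredholmDet_comp_of_minor_eq_zero {β : Type*} [MeasurableSpace β] {ν : Measure β}
    [SigmaFinite μ] [SigmaFinite ν] {e : β → α} (he : MeasurableEmbedding e)
    (hν : ν.map e = μ.restrict (Set.range e))
    (hk : Measurable (Function.uncurry k))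
    (h0 : ∀ (m : ℕ) (x : Fin m → α), (∃ i, x i ∉ Set.range e) → fredholmMinor k m x = 0) :
    fredholmDet μ k = fredholmDet ν fun s t => k (e s) (e t) := by
  unfold fredholmDet
  congr 1
  funext m
  congr 1
  have hmp : MeasurePreserving e ν (μ.restrict (Set.range e)) := ⟨he.measurable, hν⟩
  have hmp' : MeasurePreserving (fun (x : Fin m → β) i => e (x i)) (Measure.pi fun _ => ν)
      (Measure.pi fun _ => μ.restrict (Set.range e)) :=
    measurePreserving_pi (fun _ => ν) _ fun _ => hmp
  have hmeas : Measurable (fredholmMinor k m) := by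
    unfold fredholmMinor
    simp only [Matrix.det_apply]
    exact Finset.measurable_sum _ fun σ _ => (Finset.measurable_prod _ fun i _ =>
      hk.comp (by fun_prop : Measurable fun x : Fin m → α => (x (σ i), x i))).const_smul _
  calc ∫ x, fredholmMinor k m x ∂(Measure.pi fun _ : Fin m => μ)
      = ∫ x in Set.univ.pi fun _ => Set.range e, fredholmMinor k m x
          ∂(Measure.pi fun _ : Fin m => μ) := by
        refine (setIntegral_eq_integral_of_forall_compl_eq_zero fun x hx => h0 m x ?_).symm
        simpa [Set.mem_pi] using hx
    _ = ∫ x, fredholmMinor k m x ∂(Measure.pi fun _ : Fin m => μ.restrict (Set.range e)) := by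
        rw [Measure.restrict_pi_pi]
    _ = ∫ x, fredholmMinor k m (fun i => e (x i)) ∂(Measure.pi fun _ : Fin m => ν) := by
        rw [← hmp'.map_eq, integral_map hmp'.measurable.aemeasurable hmeas.aestronglyMeasurable]
    _ = _ := rfl

end

/-! ### The Airy function on shifted contours -/

/-- The integrand `exp (ζ ^ 3 / 3 - x ζ)` of the Airy function at the point `ζ = r + i s` of the
vertical line `Re ζ = r`. -/
def contourIntegrand (r x s : ℝ) : ℂ :=
  Complex.exp ((r + s * Complex.I) ^ 3 / 3 - x * (r + s * Complex.I))

theorem contourIntegrand_one (x s : ℝ) : contourIntegrand 1 x s = airyIntegrand x s := by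
  simp [contourIntegrand, airyIntegrand]

theorem norm_contourIntegrand (r x s : ℝ) :
    ‖contourIntegrand r x s‖ = Real.exp (r ^ 3 / 3 - r * s ^ 2 - r * x) := by
  unfold contourIntegrand
  rw [Complex.norm_exp]
  congr 1
  have : (((r : ℂ) + (s : ℂ) * Complex.I) ^ 3 / 3 - x * (r + s * Complex.I))
      = ((r ^ 3 / 3 - r * s ^ 2 - r * x : ℝ) : ℂ)
        + ((r ^ 2 * s - s ^ 3 / 3 - x * s : ℝ) : ℂ) * Complex.I := by
    have hI : Complex.I ^ 3 = -Complex.I := by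
      rw [pow_succ, Complex.I_sq]; ring
    push_cast
    ring_nf
    rw [hI, Complex.I_sq]
    ring
  rw [this, Complex.add_re, Complex.ofReal_re, Complex.re_ofReal_mul, Complex.I_re]
  ring

theorem continuous_contourIntegrand (r x : ℝ) : Continuous (contourIntegrand r x) := by
  unfold contourIntegrand
  fun_prop

theorem integrable_exp_sub_mul_sq {r : ℝ} (hr : 0 < r) (c : ℝ) :
    Integrable fun s : ℝ => Real.exp (c - r * s ^ 2) := by
  refine ((integrable_exp_neg_mul_sq hr).const_mul (Real.exp c)).congr (ae_of_all _ fun s => ?_)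
  simp only [← Real.exp_add]
  congr 1
  ring

theorem integrable_contourIntegrand {r : ℝ} (hr : 0 < r) (x : ℝ) :
    Integrable (contourIntegrand r x) := by
  refine (integrable_exp_sub_mul_sq hr (r ^ 3 / 3 - r * x)).mono'
    (continuous_contourIntegrand r x).aestronglyMeasurable (ae_of_all _ fun s => le_of_eq ?_)
  rw [norm_contourIntegrand]
  congr 1
  ring

/-- The derivative of the integrand in the abscissa `r`, locally uniformly dominated. -/
theorem norm_mul_contourIntegrand_le {r₀ r : ℝ} (hr₀ : 0 < r₀) (hr : |r - r₀| < r₀ / 2) (x s : ℝ) :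
    ‖((r + s * Complex.I : ℂ) ^ 2 - x) * contourIntegrand r x s‖ ≤
      (4 * r₀ ^ 2 + |x| + 4 / r₀) * Real.exp (9 * r₀ ^ 3 + 2 * r₀ * |x| - (r₀ / 4) * s ^ 2) := by
  obtain ⟨h1, h2⟩ := abs_lt.1 hr
  have hc : 0 < r₀ / 4 := by positivity
  have hn : ‖((r + s * Complex.I : ℂ) ^ 2 - x)‖ ≤ 4 * r₀ ^ 2 + |x| + s ^ 2 := by
    refine (norm_sub_le _ _).trans ?_
    rw [norm_pow, ← Complex.normSq_eq_norm_sq, Complex.normSq_add_mul_I, Complex.norm_real,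
      Real.norm_eq_abs]
    nlinarith
  have hs : 4 * r₀ ^ 2 + |x| + s ^ 2 ≤
      (4 * r₀ ^ 2 + |x| + 4 / r₀) * Real.exp ((r₀ / 4) * s ^ 2) := by
    have e1 : (1 : ℝ) ≤ Real.exp ((r₀ / 4) * s ^ 2) := Real.one_le_exp (by positivity)
    have e2 : s ^ 2 ≤ 4 / r₀ * Real.exp ((r₀ / 4) * s ^ 2) := by
      have := Real.add_one_le_exp ((r₀ / 4) * s ^ 2)
      calc s ^ 2 = 4 / r₀ * ((r₀ / 4) * s ^ 2) := by field_simp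
        _ ≤ _ := mul_le_mul_of_nonneg_left (by linarith) (by positivity)
    have e3 : 4 * r₀ ^ 2 + |x| ≤ (4 * r₀ ^ 2 + |x|) * Real.exp ((r₀ / 4) * s ^ 2) :=
      le_mul_of_one_le_right (by positivity) e1
    rw [add_mul]
    linarith
  rw [norm_mul, norm_contourIntegrand]
  calc _ ≤ ((4 * r₀ ^ 2 + |x| + 4 / r₀) * Real.exp ((r₀ / 4) * s ^ 2)) *
        Real.exp (r ^ 3 / 3 - r * s ^ 2 - r * x) := by
        gcongr
        exact hn.trans hs
    _ = (4 * r₀ ^ 2 + |x| + 4 / r₀) *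
        Real.exp ((r₀ / 4) * s ^ 2 + (r ^ 3 / 3 - r * s ^ 2 - r * x)) := by
        rw [Real.exp_add]; ring
    _ ≤ _ := by
        gcongr
        have e1 : -(r * x) ≤ 2 * r₀ * |x| := by
          have := neg_abs_le x
          have := abs_nonneg x
          nlinarith
        have e2 : r ^ 3 ≤ (2 * r₀) ^ 3 := pow_le_pow_left₀ (by linarith) (by linarith) 3
        have e3 : (r₀ / 2) * s ^ 2 ≤ r * s ^ 2 :=
          mul_le_mul_of_nonneg_right (by linarith) (sq_nonneg s)
        nlinarith [pow_pos hr₀ 3]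

theorem hasDerivAt_integral_contourIntegrand {r : ℝ} (hr : 0 < r) (x : ℝ) :
    HasDerivAt (fun r => ∫ s : ℝ, contourIntegrand r x s) 0 r := by
  have hcont : Continuous fun s : ℝ =>
      ((r + s * Complex.I : ℂ) ^ 2 - x) * contourIntegrand r x s :=
    (by fun_prop : Continuous fun s : ℝ => ((r + s * Complex.I : ℂ) ^ 2 - x)).mul
      (continuous_contourIntegrand r x)
  have hdom := hasDerivAt_integral_of_dominated_loc_of_deriv_le
    (F := fun (r : ℝ) (s : ℝ) => contourIntegrand r x s)
    (F' := fun (r : ℝ) (s : ℝ) => ((r + s * Complex.I : ℂ) ^ 2 - x) * contourIntegrand r x s)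
    (Metric.ball_mem_nhds r (half_pos hr))
    (Filter.Eventually.of_forall fun r => (continuous_contourIntegrand r x).aestronglyMeasurable)
    (integrable_contourIntegrand hr x) hcont.aestronglyMeasurable
    (ae_of_all _ fun s r' hr' => norm_mul_contourIntegrand_le hr
      (by simpa [Real.dist_eq] using hr') x s)
    ((integrable_exp_sub_mul_sq (by positivity) _).const_mul _)
    (ae_of_all _ fun s r' _ => by
      have h1 : HasDerivAt (fun r : ℝ => (r : ℂ) + (s : ℂ) * Complex.I) 1 r' :=
        ((hasDerivAt_id r').ofReal_comp.add_const _)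
      have h2 : HasDerivAt (fun r : ℝ => contourIntegrand r x s) (contourIntegrand r' x s *
          (((3 : ℕ) : ℂ) * (r' + (s : ℂ) * Complex.I) ^ (3 - 1) * 1 / 3 - x * 1)) r' :=
        (((h1.pow 3).div_const 3).sub (h1.const_mul (x : ℂ))).cexp
      refine h2.congr_deriv ?_
      push_cast
      ring)
  -- the derivative of the integrand in `r` is `-i` times its derivative in `s`
  have hz : ∫ s : ℝ, ((r + s * Complex.I : ℂ) ^ 2 - x) * contourIntegrand r x s = 0 := by
    have hd : ∀ s : ℝ, HasDerivAt (contourIntegrand r x)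
        (Complex.I * (((r + s * Complex.I : ℂ) ^ 2 - x) * contourIntegrand r x s)) s := by
      intro s
      have h1 : HasDerivAt (fun s : ℝ => (r : ℂ) + (s : ℂ) * Complex.I) (1 * Complex.I) s :=
        ((hasDerivAt_id s).ofReal_comp.mul_const _).const_add _
      have h2 : HasDerivAt (contourIntegrand r x) (contourIntegrand r x s *
          (((3 : ℕ) : ℂ) * (r + (s : ℂ) * Complex.I) ^ (3 - 1) * (1 * Complex.I) / 3
            - x * (1 * Complex.I))) s :=
        (((h1.pow 3).div_const 3).sub (h1.const_mul (x : ℂ))).cexp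
      convert h2 using 1
      push_cast
      ring
    have h0 := integral_eq_zero_of_hasDerivAt_of_integrable hd (hdom.1.const_mul Complex.I)
      (integrable_contourIntegrand hr x)
    rw [integral_const_mul] at h0
    exact (mul_eq_zero.1 h0).resolve_left Complex.I_ne_zero
  rw [← hz]
  exact hdom.2

theorem integral_contourIntegrand_eq {r r' : ℝ} (hr : 0 < r) (hr' : 0 < r') (x : ℝ) :
    ∫ s : ℝ, contourIntegrand r x s = ∫ s : ℝ, contourIntegrand r' x s :=
  isOpen_Ioi.is_const_of_deriv_eq_zero (f := fun r => ∫ s : ℝ, contourIntegrand r x s)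
    isPreconnected_Ioi
    (fun _ h => (hasDerivAt_integral_contourIntegrand h x).differentiableAt.differentiableWithinAt)
    (fun _ h => (hasDerivAt_integral_contourIntegrand h x).deriv) hr hr'

theorem conj_contourIntegrand (r x s : ℝ) :
    (starRingEnd ℂ) (contourIntegrand r x s) = contourIntegrand r x (-s) := by
  unfold contourIntegrand
  rw [← Complex.exp_conj]
  simp [map_ofNat]

/-- The contour of the Airy function may be moved to any line in the right half plane. -/
theorem integral_contourIntegrand {r : ℝ} (hr : 0 < r) (x : ℝ) :
    ∫ s : ℝ, contourIntegrand r x s = ((2 * Real.pi * Ai x : ℝ) : ℂ) := by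
  have hreal : (starRingEnd ℂ) (∫ s : ℝ, contourIntegrand 1 x s) =
      ∫ s : ℝ, contourIntegrand 1 x s := by
    rw [← integral_conj]
    simp_rw [conj_contourIntegrand]
    exact integral_neg_eq_self (contourIntegrand 1 x) volume
  rw [integral_contourIntegrand_eq hr one_pos, ← Complex.conj_eq_iff_re.1 hreal]
  unfold Ai
  simp_rw [← contourIntegrand_one]
  rw [← mul_assoc, mul_inv_cancel₀ (by positivity), one_mul]

theorem exists_abs_Ai_le {r : ℝ} (hr : 0 < r) :
    ∃ C, 0 ≤ C ∧ ∀ x, |Ai x| ≤ C * Real.exp (-(r * x)) := by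
  refine ⟨(2 * Real.pi)⁻¹ * ∫ s : ℝ, Real.exp (r ^ 3 / 3 - r * s ^ 2), ?_, fun x => ?_⟩
  · exact mul_nonneg (by positivity) (integral_nonneg fun s => (Real.exp_pos _).le)
  · have h1 := norm_integral_le_integral_norm (μ := volume) (contourIntegrand r x)
    rw [integral_contourIntegrand hr, Complex.norm_real, Real.norm_eq_abs, abs_mul,
      abs_of_pos (by positivity)] at h1
    simp_rw [norm_contourIntegrand, sub_eq_add_neg _ (r * x), Real.exp_add _ (-(r * x))] at h1
    rw [integral_mul_const] at h1
    rw [mul_assoc, ← div_eq_inv_mul, le_div_iff₀ (by positivity), mul_comm]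
    exact h1

theorem continuous_Ai : Continuous Ai :=
  continuous_iff_continuousAt.2 fun x => (hasDerivAt_Ai x).continuousAt

/-- Two contours at once: the abscissa can be chosen according to the sign of `E`. -/
theorem exists_abs_eigenfunction_le {r r' : ℝ} (hr : 0 < r) (hr' : 0 < r') :
    ∃ C, 0 ≤ C ∧ ∀ E x, |eigenfunction E x| ≤
      C * (Real.exp (-(r * x)) + Real.exp (-(r' * x))) *
        min (Real.exp (r * E)) (Real.exp (r' * E)) := by
  obtain ⟨C, hC, h⟩ := exists_abs_Ai_le hr
  obtain ⟨C', hC', h'⟩ := exists_abs_Ai_le hr'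
  refine ⟨C + C', by positivity, fun E x => ?_⟩
  unfold eigenfunction
  rw [mul_min_of_nonneg _ _ (by positivity)]
  refine le_min ?_ ?_
  · refine (h (x - E)).trans ?_
    rw [show -(r * (x - E)) = -(r * x) + r * E by ring, Real.exp_add, ← mul_assoc]
    gcongr
    · linarith
    · linarith [Real.exp_pos (-(r' * x))]
  · refine (h' (x - E)).trans ?_
    rw [show -(r' * (x - E)) = -(r' * x) + r' * E by ring, Real.exp_add, ← mul_assoc]
    gcongr
    · linarith
    · linarith [Real.exp_pos (-(r * x))]

/-! ### The heat kernel of the Airy Hamiltonian -/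

/-- The closed form of the kernel of `e^{-tH}`. -/
def airyHeat (t x y : ℝ) : ℝ :=
  √(Real.pi / t) / (2 * Real.pi) *
    Real.exp (t ^ 3 / 12 - t * (x + y) / 2 - (x - y) ^ 2 / (4 * t))

theorem airyHeat_nonneg (t x y : ℝ) : 0 ≤ airyHeat t x y := by
  unfold airyHeat
  positivity

theorem airyHeat_comm (t x y : ℝ) : airyHeat t x y = airyHeat t y x := by
  unfold airyHeat
  rw [add_comm x y, ← neg_sub x y, neg_sq]

theorem continuous_airyHeat (t : ℝ) : Continuous fun p : ℝ × ℝ => airyHeat t p.1 p.2 := by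
  unfold airyHeat
  fun_prop

/-- The Gaussian integral of the heat kernel against a complex exponential. -/
theorem integral_airyHeat_mul_cexp {t : ℝ} (ht : 0 < t) (x : ℝ) (ζ : ℂ) :
    Integrable (fun z : ℝ => (airyHeat t x z : ℂ) * Complex.exp (-(z * ζ))) ∧
    ∫ z : ℝ, (airyHeat t x z : ℂ) * Complex.exp (-(z * ζ)) =
      Complex.exp (((ζ + t) ^ 3 - ζ ^ 3) / 3 - x * (ζ + t)) := by
  have htc : (t : ℂ) ≠ 0 := by exact_mod_cast ht.ne'
  set b : ℂ := ((-(1 / (4 * t)) : ℝ) : ℂ) with hb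
  set c : ℂ := x / (2 * t) - t / 2 - ζ with hc
  set d : ℂ := t ^ 3 / 12 - t * x / 2 - x ^ 2 / (4 * t) with hd
  have hbre : b.re < 0 := by
    rw [hb, Complex.ofReal_re, neg_lt_zero]
    positivity
  have hfun : (fun z : ℝ => (airyHeat t x z : ℂ) * Complex.exp (-(z * ζ))) =
      fun z : ℝ => ((√(Real.pi / t) / (2 * Real.pi) : ℝ) : ℂ) *
        Complex.exp (b * z ^ 2 + c * z + d) := by
    funext z
    unfold airyHeat
    rw [Complex.ofReal_mul, Complex.ofReal_exp, mul_assoc, ← Complex.exp_add]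
    congr 2
    rw [hb, hc, hd]
    push_cast
    field_simp
    ring
  have hnorm : ((√(Real.pi / t) / (2 * Real.pi) : ℝ) : ℂ) * (Real.pi / -b) ^ (1 / 2 : ℂ) = 1 := by
    have e1 : (Real.pi / -b : ℂ) = ((Real.pi * (4 * t) : ℝ) : ℂ) := by
      rw [hb]
      push_cast
      field_simp
    rw [e1, show (1 / 2 : ℂ) = ((1 / 2 : ℝ) : ℂ) by push_cast; rfl,
      ← Complex.ofReal_cpow (by positivity), ← Real.sqrt_eq_rpow, ← Complex.ofReal_mul,
      div_mul_eq_mul_div, ← Real.sqrt_mul (by positivity),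
      show Real.pi / t * (Real.pi * (4 * t)) = (2 * Real.pi) ^ 2 by field_simp; ring,
      Real.sqrt_sq (by positivity), div_self (by positivity), Complex.ofReal_one]
  rw [hfun]
  refine ⟨(integrable_cexp_quadratic' hbre c d).const_mul _, ?_⟩
  rw [integral_const_mul, integral_cexp_quadratic hbre, ← mul_assoc, hnorm, one_mul]
  congr 1
  rw [hb, hc, hd]
  push_cast
  field_simp
  ring

theorem integral_airyHeat_mul_exp {t : ℝ} (ht : 0 < t) (x c : ℝ) :
    Integrable (fun z : ℝ => airyHeat t x z * Real.exp (-(c * z))) ∧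
    ∫ z : ℝ, airyHeat t x z * Real.exp (-(c * z)) =
      Real.exp (((c + t) ^ 3 - c ^ 3) / 3) * Real.exp (-((c + t) * x)) := by
  obtain ⟨h1, h2⟩ := integral_airyHeat_mul_cexp ht x c
  have hfun : (fun z : ℝ => (airyHeat t x z : ℂ) * Complex.exp (-(z * c))) =
      fun z : ℝ => ((airyHeat t x z * Real.exp (-(c * z)) : ℝ) : ℂ) := by
    funext z
    push_cast
    rw [mul_comm (z : ℂ)]
  rw [hfun] at h1 h2
  refine ⟨by simpa only [RCLike.re_to_complex, Complex.ofReal_re] using h1.re, ?_⟩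
  rw [integral_complex_ofReal] at h2
  apply Complex.ofReal_injective
  rw [h2, ← Real.exp_add]
  push_cast
  congr 1
  ring

/-- The heat kernel acts on the generalized eigenfunctions as `e^{-tH}`. -/
theorem integral_airyHeat_mul_eigenfunction {t : ℝ} (ht : 0 < t) (x E : ℝ) :
    ∫ z : ℝ, airyHeat t x z * eigenfunction E z = Real.exp (-(t * E)) * eigenfunction E x := by
  set F : ℝ → ℝ → ℂ := fun z s => (airyHeat t x z : ℂ) * contourIntegrand 1 (z - E) s with hF
  have hFeq : ∀ z s, F z s = (airyHeat t x z : ℂ) * Complex.exp (-(z * (1 + s * Complex.I))) *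
      Complex.exp ((1 + s * Complex.I) ^ 3 / 3 + E * (1 + s * Complex.I)) := by
    intro z s
    simp only [hF, contourIntegrand]
    rw [mul_assoc, ← Complex.exp_add]
    congr 2
    push_cast
    ring
  have hFi : Integrable (Function.uncurry F) (volume.prod volume) := by
    have hb : Integrable (fun p : ℝ × ℝ => airyHeat t x p.1 * Real.exp (-(1 * p.1)) *
        Real.exp (1 / 3 + E - 1 * p.2 ^ 2)) (volume.prod volume) :=
      (integral_airyHeat_mul_exp ht x 1).1.mul_prod (integrable_exp_sub_mul_sq one_pos (1 / 3 + E))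
    refine hb.mono' ?_ (ae_of_all _ fun p => le_of_eq ?_)
    · refine Continuous.aestronglyMeasurable ?_
      have h1 : Continuous fun p : ℝ × ℝ => airyHeat t x p.1 := by
        unfold airyHeat
        fun_prop
      simp only [hF, Function.uncurry_def, contourIntegrand]
      fun_prop
    · simp only [Function.uncurry_def, hF]
      rw [norm_mul, norm_contourIntegrand, Complex.norm_real, Real.norm_eq_abs,
        abs_of_nonneg (airyHeat_nonneg _ _ _), mul_assoc, ← Real.exp_add]
      congr 2
      ring
  have hswap := integral_integral_swap hFi
  have hL : ∀ z, ∫ s, F z s = ((2 * Real.pi * (airyHeat t x z * eigenfunction E z) : ℝ) : ℂ) := by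
    intro z
    simp only [hF]
    rw [integral_const_mul, integral_contourIntegrand one_pos]
    unfold eigenfunction
    push_cast
    ring
  have hR : ∀ s, ∫ z, F z s =
      ((Real.exp (-(t * E)) : ℝ) : ℂ) * contourIntegrand (1 + t) (x - E) s := by
    intro s
    simp_rw [hFeq]
    rw [integral_mul_const, (integral_airyHeat_mul_cexp ht x _).2, ← Complex.exp_add,
      Complex.ofReal_exp]
    unfold contourIntegrand
    rw [← Complex.exp_add]
    congr 1
    push_cast
    ring
  simp_rw [hL, hR] at hswap
  rw [integral_const_mul, integral_contourIntegrand (by positivity), integral_complex_ofReal,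
    integral_const_mul, ← Complex.ofReal_mul] at hswap
  have h3 := Complex.ofReal_injective hswap
  have h4 : (2 * Real.pi) ≠ 0 := by positivity
  apply mul_left_cancel₀ h4
  rw [h3]
  unfold eigenfunction
  ring

theorem integrable_exp_neg_mul_abs {c : ℝ} (hc : 0 < c) :
    Integrable fun E : ℝ => Real.exp (-(c * |E|)) := by
  rw [← integrableOn_univ, ← Set.Iic_union_Ioi (a := (0 : ℝ))]
  refine IntegrableOn.union ?_ ?_
  · refine (integrableOn_exp_mul_Iic hc 0).congr_fun (fun E hE => ?_) measurableSet_Iic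
    simp only
    rw [abs_of_nonpos hE]
    ring_nf
  · refine (integrableOn_exp_mul_Ioi (neg_lt_zero.2 hc) 0).congr_fun (fun E hE => ?_)
      measurableSet_Ioi
    simp only
    rw [abs_of_pos hE]
    ring_nf

theorem integrable_exp_mul_Ai {r : ℝ} (hr : 0 < r) :
    Integrable fun u : ℝ => Real.exp (r * u) * Ai u := by
  obtain ⟨C, hC, h⟩ := exists_abs_Ai_le (r := r / 2) (by positivity)
  obtain ⟨C', hC', h'⟩ := exists_abs_Ai_le (r := 3 * r / 2) (by positivity)
  refine ((integrable_exp_neg_mul_abs (half_pos hr)).const_mul (C + C')).mono'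
    ((by fun_prop : Continuous fun u : ℝ => Real.exp (r * u)).mul
      continuous_Ai).aestronglyMeasurable (ae_of_all _ fun u => ?_)
  rw [norm_mul, Real.norm_eq_abs, Real.norm_eq_abs, Real.abs_exp]
  rcases le_total 0 u with hu | hu
  · calc _ ≤ Real.exp (r * u) * (C' * Real.exp (-(3 * r / 2 * u))) := by gcongr; exact h' u
      _ = C' * Real.exp (-(r / 2 * |u|)) := by
        rw [mul_left_comm, ← Real.exp_add, abs_of_nonneg hu]; ring_nf
      _ ≤ _ := by gcongr; linarith
  · calc _ ≤ Real.exp (r * u) * (C * Real.exp (-(r / 2 * u))) := by gcongr; exact h u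
      _ = C * Real.exp (-(r / 2 * |u|)) := by
        rw [mul_left_comm, ← Real.exp_add, abs_of_nonpos hu]; ring_nf
      _ ≤ _ := by gcongr; linarith

open FourierTransform in
theorem fourier_contourIntegrand {r : ℝ} (hr : 0 < r) (x w : ℝ) :
    𝓕 (contourIntegrand r x) w = ((2 * Real.pi * Real.exp (-(r * x)) *
      (Real.exp (r * (x + 2 * Real.pi * w)) * Ai (x + 2 * Real.pi * w)) : ℝ) : ℂ) := by
  rw [Real.fourier_real_eq_integral_exp_smul]
  have h1 : ∀ v : ℝ, Complex.exp (↑(-2 * Real.pi * v * w) * Complex.I) • contourIntegrand r x v =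
      ((Real.exp (r * (2 * Real.pi * w)) : ℝ) : ℂ) *
        contourIntegrand r (x + 2 * Real.pi * w) v := by
    intro v
    unfold contourIntegrand
    rw [smul_eq_mul, Complex.ofReal_exp, ← Complex.exp_add, ← Complex.exp_add]
    congr 1
    push_cast
    ring
  simp_rw [h1]
  rw [integral_const_mul, integral_contourIntegrand hr, ← Complex.ofReal_mul]
  congr 1
  rw [mul_add r, Real.exp_add, Real.exp_neg]
  field_simp

open FourierTransform in
/-- Parseval's identity for the functions `e^{-tE/2} Ai(x - E)` of `E`, whose Fourier transforms
are the integrands of the Airy function on the contour `Re ζ = t / 2`. -/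
theorem expH_eq_airyHeat {t : ℝ} (ht : 0 < t) : expH (-t) = airyHeat t := by
  funext x y
  set r : ℝ := t / 2 with hr
  have hr0 : 0 < r := by positivity
  have hFi : ∀ x, Integrable (𝓕 (contourIntegrand r x)) := by
    intro x
    have h1 : Integrable fun w : ℝ =>
        Real.exp (r * (x + 2 * Real.pi * w)) * Ai (x + 2 * Real.pi * w) :=
      ((integrable_exp_mul_Ai hr0).comp_add_left x).comp_mul_left' (by positivity)
    refine ((h1.const_mul (2 * Real.pi * Real.exp (-(r * x)))).ofReal (𝕜 := ℂ)).congr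
      (ae_of_all _ fun w => ?_)
    rw [fourier_contourIntegrand hr0]
    rfl
  have hinv : ∀ s, 𝓕 (𝓕 (contourIntegrand r x)) s = contourIntegrand r x (-s) := by
    intro s
    rw [← (continuous_contourIntegrand r x).fourierInv_fourier_eq
      (integrable_contourIntegrand hr0 x) (hFi x), Real.fourierInv_eq_fourier_neg, neg_neg,
      (continuous_contourIntegrand r x).fourierInv_fourier_eq
      (integrable_contourIntegrand hr0 x) (hFi x)]
  have hflip : ∫ w, 𝓕 (contourIntegrand r y) w • 𝓕 (contourIntegrand r x) w =
      ∫ s, contourIntegrand r y s • 𝓕 (𝓕 (contourIntegrand r x)) s := by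
    have h := VectorFourier.integral_fourierIntegral_smul_eq_flip (L := innerₗ ℝ)
      Real.continuous_fourierChar continuous_inner (integrable_contourIntegrand hr0 y) (hFi x)
    rw [flip_innerₗ] at h
    exact h
  have hL : ∀ w, 𝓕 (contourIntegrand r y) w • 𝓕 (contourIntegrand r x) w =
      (((2 * Real.pi) ^ 2 * spectralIntegrand (expSymbol (-t)) x y (-(2 * Real.pi) * w) : ℝ) : ℂ) :=
    by
    intro w
    rw [fourier_contourIntegrand hr0, fourier_contourIntegrand hr0, smul_eq_mul,
      ← Complex.ofReal_mul]
    unfold spectralIntegrand expSymbol eigenfunction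
    rw [show x - -(2 * Real.pi) * w = x + 2 * Real.pi * w by ring,
      show y - -(2 * Real.pi) * w = y + 2 * Real.pi * w by ring,
      show -t * (-(2 * Real.pi) * w) = -(r * y) + r * (y + 2 * Real.pi * w) +
        (-(r * x) + r * (x + 2 * Real.pi * w)) by rw [hr]; ring,
      Real.exp_add, Real.exp_add, Real.exp_add]
    congr 1
    ring
  have hR : ∀ s, contourIntegrand r y s • 𝓕 (𝓕 (contourIntegrand r x)) s =
      Complex.exp (((-t : ℝ) : ℂ) * s ^ 2 + (-(y - x) * Complex.I) * s +
        (t ^ 3 / 12 - t * (x + y) / 2)) := by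
    intro s
    rw [hinv, smul_eq_mul]
    unfold contourIntegrand
    rw [← Complex.exp_add, hr]
    congr 1
    push_cast
    ring_nf
    rw [Complex.I_sq]
    ring
  simp_rw [hL, hR] at hflip
  rw [integral_cexp_quadratic (by simpa using ht), integral_complex_ofReal, integral_const_mul,
    Measure.integral_comp_mul_left (spectralIntegrand (expSymbol (-t)) x y)] at hflip
  have hG : ((Real.pi : ℂ) / -((-t : ℝ) : ℂ)) ^ (1 / 2 : ℂ) *
      Complex.exp ((t ^ 3 / 12 - t * (x + y) / 2) - (-(y - x) * Complex.I) ^ 2 /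
        (4 * ((-t : ℝ) : ℂ))) = ((2 * Real.pi * airyHeat t x y : ℝ) : ℂ) := by
    have e1 : (Real.pi : ℂ) / -((-t : ℝ) : ℂ) = ((Real.pi / t : ℝ) : ℂ) := by
      push_cast
      rw [neg_neg]
    rw [e1, show (1 / 2 : ℂ) = ((1 / 2 : ℝ) : ℂ) by push_cast; rfl,
      ← Complex.ofReal_cpow (by positivity), ← Real.sqrt_eq_rpow]
    unfold airyHeat
    rw [← mul_assoc, mul_div_cancel₀ _ (by positivity : 2 * Real.pi ≠ 0), Complex.ofReal_mul,
      Complex.ofReal_exp]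
    congr 2
    rw [mul_pow, Complex.I_sq]
    have htc : (t : ℂ) ≠ 0 := by exact_mod_cast ht.ne'
    push_cast
    field_simp
    ring
  rw [hG] at hflip
  have h5 := Complex.ofReal_injective hflip
  rw [abs_inv, abs_neg, abs_of_pos (by positivity), smul_eq_mul, ← mul_assoc, sq,
    mul_assoc (2 * Real.pi), mul_inv_cancel₀ (by positivity), mul_one] at h5
  exact mul_left_cancel₀ (by positivity) h5

/-! ### Functions of the Airy Hamiltonian and their products with the heat kernel -/

/-- A symbol `f` for which the spectral integral of `f(H)` converges absolutely, by the bounds of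
the Airy function on two contours, of abscissas `r` and `r'`. -/
structure IsAdmissibleSymbol (f : ℝ → ℝ) : Prop where
  measurable : Measurable f
  integrable : ∃ r r' : ℝ, 0 < r ∧ 0 < r' ∧
    Integrable fun E => |f E| * min (Real.exp (r * E)) (Real.exp (r' * E)) ^ 2

theorem isAdmissibleSymbol_expNegSymbol (s : ℝ) : IsAdmissibleSymbol (expNegSymbol s) := by
  have hm : Measurable (expNegSymbol s) :=
    Measurable.ite measurableSet_Iio (by fun_prop) measurable_const
  refine ⟨hm, |s| + 1, |s| + 1, by positivity, by positivity, ?_⟩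
  have h1 : Integrable ((Set.Iic (0 : ℝ)).indicator fun E => Real.exp (1 * E)) :=
    (integrable_indicator_iff measurableSet_Iic).2 (integrableOn_exp_mul_Iic one_pos 0)
  refine h1.mono' (by fun_prop) (ae_of_all _ fun E => ?_)
  rw [min_self, Real.norm_eq_abs, abs_of_nonneg (by positivity)]
  unfold expNegSymbol
  by_cases hE : E < 0
  · rw [if_pos hE, Set.indicator_of_mem (by exact hE.le), Real.abs_exp, ← Real.exp_nat_mul,
      ← Real.exp_add]
    apply Real.exp_le_exp.2
    push_cast
    nlinarith [neg_abs_le s, abs_nonneg s]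
  · rw [if_neg hE, abs_zero, zero_mul]
    exact Set.indicator_nonneg (fun _ _ => (Real.exp_pos _).le) _

theorem isAdmissibleSymbol_expSymbol {t : ℝ} (ht : 0 < t) :
    IsAdmissibleSymbol (expSymbol (-t)) := by
  have hm : Measurable (expSymbol (-t)) := by
    unfold expSymbol
    fun_prop
  refine ⟨hm, t / 4, t, by positivity, ht, ?_⟩
  refine (integrable_exp_neg_mul_abs (half_pos ht)).mono' (by fun_prop) (ae_of_all _ fun E => ?_)
  rw [Real.norm_eq_abs, abs_of_nonneg (by positivity)]
  unfold expSymbol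
  rw [Real.abs_exp]
  rcases le_total 0 E with hE | hE
  · calc _ ≤ Real.exp (-t * E) * Real.exp (t / 4 * E) ^ 2 := by
          gcongr
          exact min_le_left _ _
      _ = _ := by
          rw [← Real.exp_nat_mul, ← Real.exp_add, abs_of_nonneg hE]
          congr 1
          push_cast
          ring
  · calc _ ≤ Real.exp (-t * E) * Real.exp (t * E) ^ 2 := by
          gcongr
          exact min_le_right _ _
      _ ≤ _ := by
          rw [← Real.exp_nat_mul, ← Real.exp_add, abs_of_nonpos hE]
          apply Real.exp_le_exp.2
          push_cast
          nlinarith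

theorem measurable_spectralIntegrand {f : ℝ → ℝ} (hf : Measurable f) :
    Measurable fun p : (ℝ × ℝ) × ℝ => spectralIntegrand f p.1.1 p.1.2 p.2 := by
  have := continuous_Ai.measurable
  unfold spectralIntegrand eigenfunction
  fun_prop

theorem measurable_spectralIntegrand_left {f : ℝ → ℝ} (hf : Measurable f) (y : ℝ) :
    Measurable fun p : ℝ × ℝ => spectralIntegrand f p.1 y p.2 := by
  have := continuous_Ai.measurable
  unfold spectralIntegrand eigenfunction
  fun_prop

theorem measurable_airyHeat_left (t x : ℝ) : Measurable (airyHeat t x) := by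
  unfold airyHeat
  fun_prop

theorem measurable_spectralKernel {f : ℝ → ℝ} (hf : Measurable f) :
    Measurable (Function.uncurry (spectralKernel f)) :=
  ((measurable_spectralIntegrand hf).stronglyMeasurable.integral_prod_right
    (ν := volume)).measurable

theorem spectralKernel_comm (f : ℝ → ℝ) (x y : ℝ) :
    spectralKernel f x y = spectralKernel f y x := by
  unfold spectralKernel spectralIntegrand
  congr 1
  funext E
  ring

theorem IsAdmissibleSymbol.exists_bound {f : ℝ → ℝ} (hf : IsAdmissibleSymbol f) :
    ∃ (g : ℝ → ℝ) (r r' : ℝ), Integrable g ∧ ∀ x y E, |spectralIntegrand f x y E| ≤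
      (Real.exp (-(r * x)) + Real.exp (-(r' * x))) *
        ((Real.exp (-(r * y)) + Real.exp (-(r' * y))) * g E) := by
  obtain ⟨r, r', hr, hr', hi⟩ := hf.integrable
  obtain ⟨C, hC, h⟩ := exists_abs_eigenfunction_le hr hr'
  refine ⟨_, r, r', hi.const_mul (C ^ 2), fun x y E => ?_⟩
  unfold spectralIntegrand
  rw [abs_mul, abs_mul]
  calc _ ≤ |f E| * ((C * (Real.exp (-(r * x)) + Real.exp (-(r' * x))) *
        min (Real.exp (r * E)) (Real.exp (r' * E))) *
          (C * (Real.exp (-(r * y)) + Real.exp (-(r' * y))) *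
        min (Real.exp (r * E)) (Real.exp (r' * E)))) := by
        gcongr
        · exact h E x
        · exact h E y
    _ = _ := by ring

theorem IsAdmissibleSymbol.integrable_spectralIntegrand {f : ℝ → ℝ} (hf : IsAdmissibleSymbol f)
    (x y : ℝ) : Integrable (spectralIntegrand f x y) := by
  obtain ⟨g, r, r', hg, h⟩ := hf.exists_bound
  exact ((hg.const_mul _).const_mul _).mono' ((measurable_spectralIntegrand hf.measurable).comp
    (measurable_prodMk_left (x := (x, y)))).aestronglyMeasurable (ae_of_all _ (h x y))

theorem kernelMul_airyHeat_spectralKernel {t : ℝ} (ht : 0 < t) {f : ℝ → ℝ}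
    (hf : IsAdmissibleSymbol f) :
    kernelMul (airyHeat t) (spectralKernel f) =
      spectralKernel fun E => Real.exp (-(t * E)) * f E := by
  funext x y
  obtain ⟨g, r, r', hg, h⟩ := hf.exists_bound
  set F : ℝ → ℝ → ℝ := fun z E => airyHeat t x z * spectralIntegrand f z y E with hF
  have hFi : Integrable (Function.uncurry F) (volume.prod volume) := by
    have h1 : Integrable fun z => airyHeat t x z *
        (Real.exp (-(r * z)) + Real.exp (-(r' * z))) := by
      simp only [mul_add]
      exact (integral_airyHeat_mul_exp ht x r).1.add (integral_airyHeat_mul_exp ht x r').1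
    refine (h1.mul_prod (hg.const_mul
      (Real.exp (-(r * y)) + Real.exp (-(r' * y))))).mono' ?_ (ae_of_all _ fun p => ?_)
    · exact (((measurable_airyHeat_left t x).comp measurable_fst).mul
        (measurable_spectralIntegrand_left hf.measurable y)).aestronglyMeasurable
    · simp only [Function.uncurry_def, hF]
      rw [norm_mul, Real.norm_eq_abs, Real.norm_eq_abs, abs_of_nonneg (airyHeat_nonneg _ _ _),
        mul_assoc]
      exact mul_le_mul_of_nonneg_left (h _ _ _) (airyHeat_nonneg _ _ _)
  have hswap := integral_integral_swap hFi
  have hL : ∀ z, ∫ E, F z E = airyHeat t x z * spectralKernel f z y := fun z => by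
    simp only [hF]
    rw [integral_const_mul]
    rfl
  have hR : ∀ E, ∫ z, F z E =
      spectralIntegrand (fun E => Real.exp (-(t * E)) * f E) x y E := fun E => by
    have : (fun z => F z E) = fun z => (f E * eigenfunction E y) *
        (airyHeat t x z * eigenfunction E z) := by
      funext z
      simp only [hF, spectralIntegrand]
      ring
    rw [this, integral_const_mul, integral_airyHeat_mul_eigenfunction ht]
    unfold spectralIntegrand
    ring
  simp_rw [hL, hR] at hswap
  exact hswap

theorem kernelMul_spectralKernel_airyHeat {t : ℝ} (ht : 0 < t) {f : ℝ → ℝ}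
    (hf : IsAdmissibleSymbol f) :
    kernelMul (spectralKernel f) (airyHeat t) =
      spectralKernel fun E => Real.exp (-(t * E)) * f E := by
  funext x y
  rw [spectralKernel_comm, ← kernelMul_airyHeat_spectralKernel ht hf]
  unfold kernelMul
  congr 1
  funext z
  rw [spectralKernel_comm, airyHeat_comm, mul_comm]

/-- The semigroup law of the heat kernel. -/
theorem kernelMul_airyHeat_airyHeat {t u : ℝ} (ht : 0 < t) (hu : 0 < u) :
    kernelMul (airyHeat t) (airyHeat u) = airyHeat (t + u) := by
  rw [← expH_eq_airyHeat hu, ← expH_eq_airyHeat (add_pos ht hu)]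
  unfold expH
  rw [kernelMul_airyHeat_spectralKernel ht (isAdmissibleSymbol_expSymbol hu)]
  congr 1
  funext E
  unfold expSymbol
  rw [← Real.exp_add]
  congr 1
  ring

theorem exp_mul_expNegSymbol (t s : ℝ) :
    (fun E => Real.exp (-(t * E)) * expNegSymbol s E) = expNegSymbol (s - t) := by
  funext E
  unfold expNegSymbol
  split_ifs
  · rw [← Real.exp_add]
    congr 1
    ring
  · exact mul_zero _

theorem kernelMul_airyHeat_expHK {t : ℝ} (ht : 0 < t) (s : ℝ) :
    kernelMul (airyHeat t) (expHK s) = expHK (s - t) := by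
  unfold expHK
  rw [kernelMul_airyHeat_spectralKernel ht (isAdmissibleSymbol_expNegSymbol s),
    exp_mul_expNegSymbol]

theorem kernelMul_expHK_airyHeat {t : ℝ} (ht : 0 < t) (s : ℝ) :
    kernelMul (expHK s) (airyHeat t) = expHK (s - t) := by
  unfold expHK
  rw [kernelMul_spectralKernel_airyHeat ht (isAdmissibleSymbol_expNegSymbol s),
    exp_mul_expNegSymbol]

theorem spectralIntegrand_expPosSymbol (s x y : ℝ) :
    spectralIntegrand (expPosSymbol s) x y = fun E =>
      spectralIntegrand (expSymbol s) x y E - spectralIntegrand (expNegSymbol s) x y E := by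
  funext E
  unfold spectralIntegrand expPosSymbol expSymbol expNegSymbol
  split_ifs <;> ring

theorem integrable_expPosSymbol {t : ℝ} (ht : 0 < t) (x y : ℝ) :
    Integrable (spectralIntegrand (expPosSymbol (-t)) x y) := by
  rw [spectralIntegrand_expPosSymbol]
  exact ((isAdmissibleSymbol_expSymbol ht).integrable_spectralIntegrand x y).sub
    ((isAdmissibleSymbol_expNegSymbol (-t)).integrable_spectralIntegrand x y)

theorem expHOneSubK_eq {t : ℝ} (ht : 0 < t) (x y : ℝ) :
    expHOneSubK (-t) x y = airyHeat t x y - expHK (-t) x y := by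
  rw [← expH_eq_airyHeat ht]
  unfold expHOneSubK expH expHK spectralKernel
  rw [spectralIntegrand_expPosSymbol]
  exact integral_sub ((isAdmissibleSymbol_expSymbol ht).integrable_spectralIntegrand x y)
    ((isAdmissibleSymbol_expNegSymbol (-t)).integrable_spectralIntegrand x y)

/-! ### Exponential bounds of the kernels -/

theorem exists_abs_expHK_le {r r' s : ℝ} (hr : 0 < r) (hr' : 0 < r') (hs : 0 < s + r + r') :
    ∃ C, 0 ≤ C ∧ ∀ x y, |expHK s x y| ≤ C * (Real.exp (-(r * x)) * Real.exp (-(r' * y))) := by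
  obtain ⟨C, hC, h⟩ := exists_abs_Ai_le hr
  obtain ⟨C', hC', h'⟩ := exists_abs_Ai_le hr'
  have hi : Integrable ((Set.Iic (0 : ℝ)).indicator fun E => Real.exp ((s + r + r') * E)) :=
    (integrable_indicator_iff measurableSet_Iic).2 (integrableOn_exp_mul_Iic hs 0)
  have hnn : ∀ E, 0 ≤ (Set.Iic (0 : ℝ)).indicator (fun E => Real.exp ((s + r + r') * E)) E :=
    Set.indicator_nonneg fun _ _ => (Real.exp_pos _).le
  refine ⟨C * C' * ∫ E, (Set.Iic (0 : ℝ)).indicator (fun E => Real.exp ((s + r + r') * E)) E,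
    mul_nonneg (by positivity) (integral_nonneg hnn), fun x y => ?_⟩
  unfold expHK spectralKernel
  rw [← Real.norm_eq_abs]
  refine (norm_integral_le_of_norm_le (hi.const_mul
    (C * C' * (Real.exp (-(r * x)) * Real.exp (-(r' * y))))) (ae_of_all _ fun E => ?_)).trans
    (le_of_eq ?_)
  · unfold spectralIntegrand expNegSymbol eigenfunction
    by_cases hE : E < 0
    · rw [if_pos hE, Set.indicator_of_mem (by exact hE.le), Real.norm_eq_abs, abs_mul, abs_mul,
        Real.abs_exp]
      calc _ ≤ Real.exp (s * E) * ((C * Real.exp (-(r * (x - E)))) *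
            (C' * Real.exp (-(r' * (y - E))))) := by
            gcongr
            · exact h _
            · exact h' _
        _ = C * C' * (Real.exp (s * E) * Real.exp (-(r * (x - E))) *
            Real.exp (-(r' * (y - E)))) := by ring
        _ = C * C' * (Real.exp (-(r * x)) * Real.exp (-(r' * y)) *
            Real.exp ((s + r + r') * E)) := by
            simp only [← Real.exp_add]
            ring_nf
        _ = _ := by ring
    · rw [if_neg hE, zero_mul, norm_zero]
      exact mul_nonneg (by positivity) (hnn E)
  · rw [integral_const_mul]
    ring

/-- The Gaussian factor of the heat kernel absorbs any exponential tilt along `x - y`. -/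
theorem exists_airyHeat_le {t : ℝ} (ht : 0 < t) (c : ℝ) :
    ∃ C, 0 ≤ C ∧ ∀ x y, airyHeat t x y ≤ C * (Real.exp (-(c * x)) * Real.exp ((c - t) * y)) := by
  refine ⟨√(Real.pi / t) / (2 * Real.pi) * Real.exp (t ^ 3 / 12 + t * (t / 2 - c) ^ 2),
    by positivity, fun x y => ?_⟩
  unfold airyHeat
  rw [mul_assoc]
  refine mul_le_mul_of_nonneg_left ?_ (by positivity)
  rw [← Real.exp_add, ← Real.exp_add]
  apply Real.exp_le_exp.2
  -- complete the square in `y - x`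
  have h : t ^ 3 / 12 + t * (t / 2 - c) ^ 2 + (-(c * x) + (c - t) * y) -
      (t ^ 3 / 12 - t * (x + y) / 2 - (x - y) ^ 2 / (4 * t)) =
      ((y - x) - 2 * t * (t / 2 - c)) ^ 2 / (4 * t) := by
    field_simp
    ring
  have h2 : 0 ≤ ((y - x) - 2 * t * (t / 2 - c)) ^ 2 / (4 * t) := by positivity
  linarith

/-! ### Chains of heat kernels and projections -/

/-- The kernel decays like `e^{-cx - y}` for some `c ≥ 2`; the exponent in `x` grows when a heat
kernel is applied from the left. -/
structure HasExpBound (k : ℝ → ℝ → ℝ) : Prop where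
  measurable : Measurable (Function.uncurry k)
  bound : ∃ C c : ℝ, 0 ≤ C ∧ 2 ≤ c ∧ ∀ x y, |k x y| ≤ C * (Real.exp (-(c * x)) * Real.exp (-y))

/-- The kernel of `P_a R`, with `P_a` the projection onto `(a, ∞)`. -/
def upProj (a : ℝ) (R : ℝ → ℝ → ℝ) (x y : ℝ) : ℝ := if a < x then R x y else 0

theorem barProj_add_upProj (a : ℝ) (R : ℝ → ℝ → ℝ) (x y : ℝ) :
    barProj a R x y + upProj a R x y = R x y := by
  unfold barProj upProj
  by_cases h : x ≤ a
  · rw [if_pos h, if_neg (not_lt.2 h), add_zero]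
  · rw [if_neg h, if_pos (not_le.1 h), zero_add]

theorem hasExpBound_expHK {s : ℝ} (hs : 0 ≤ s) : HasExpBound (expHK s) := by
  refine ⟨measurable_spectralKernel (isAdmissibleSymbol_expNegSymbol s).measurable, ?_⟩
  obtain ⟨C, hC, h⟩ := exists_abs_expHK_le (r := 2) (r' := 1) (s := s) two_pos one_pos
    (by linarith)
  exact ⟨C, 2, hC, le_rfl, fun x y => by simpa only [one_mul] using h x y⟩

theorem HasExpBound.barProj {k : ℝ → ℝ → ℝ} (hk : HasExpBound k) (a : ℝ) :
    HasExpBound (barProj a k) := by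
  obtain ⟨C, c, hC, hc, h⟩ := hk.bound
  refine ⟨Measurable.ite (measurableSet_le measurable_fst measurable_const) hk.measurable
    measurable_const, C, c, hC, hc, fun x y => ?_⟩
  unfold AiryProc.barProj
  split_ifs
  · exact h x y
  · rw [abs_zero]
    positivity

theorem HasExpBound.upProj {k : ℝ → ℝ → ℝ} (hk : HasExpBound k) (a : ℝ) :
    HasExpBound (upProj a k) := by
  obtain ⟨C, c, hC, hc, h⟩ := hk.bound
  refine ⟨Measurable.ite (measurableSet_lt measurable_const measurable_fst) hk.measurable
    measurable_const, C, c, hC, hc, fun x y => ?_⟩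
  unfold AiryProc.upProj
  split_ifs
  · exact h x y
  · rw [abs_zero]
    positivity

theorem HasExpBound.measurable_left {k : ℝ → ℝ → ℝ} (hk : HasExpBound k) (y : ℝ) :
    Measurable fun z => k z y :=
  hk.measurable.comp measurable_prodMk_right

theorem HasExpBound.integrable_airyHeat_mul {k : ℝ → ℝ → ℝ} (hk : HasExpBound k) {t : ℝ}
    (ht : 0 < t) (x y : ℝ) : Integrable fun z => airyHeat t x z * k z y := by
  obtain ⟨C, c, hC, hc, h⟩ := hk.bound
  refine ((integral_airyHeat_mul_exp ht x c).1.const_mul (C * Real.exp (-y))).mono'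
    ((measurable_airyHeat_left t x).mul (hk.measurable_left y)).aestronglyMeasurable
    (ae_of_all _ fun z => ?_)
  rw [norm_mul, Real.norm_eq_abs, Real.norm_eq_abs, abs_of_nonneg (airyHeat_nonneg _ _ _)]
  calc _ ≤ airyHeat t x z * (C * (Real.exp (-(c * z)) * Real.exp (-y))) :=
        mul_le_mul_of_nonneg_left (h z y) (airyHeat_nonneg _ _ _)
    _ = _ := by ring

theorem HasExpBound.kernelMul_airyHeat {k : ℝ → ℝ → ℝ} (hk : HasExpBound k) {t : ℝ}
    (ht : 0 < t) : HasExpBound (kernelMul (airyHeat t) k) := by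
  obtain ⟨C, c, hC, hc, h⟩ := hk.bound
  refine ⟨?_, C * Real.exp (((c + t) ^ 3 - c ^ 3) / 3), c + t, by positivity, by linarith,
    fun x y => ?_⟩
  · have h1 : Measurable fun r : (ℝ × ℝ) × ℝ => airyHeat t r.1.1 r.2 := by
      unfold airyHeat
      fun_prop
    have h2 : Measurable fun r : (ℝ × ℝ) × ℝ => k r.2 r.1.2 :=
      hk.measurable.comp (by fun_prop : Measurable fun r : (ℝ × ℝ) × ℝ => (r.2, r.1.2))
    exact ((h1.mul h2).stronglyMeasurable.integral_prod_right (ν := volume)).measurable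
  · unfold kernelMul
    rw [← Real.norm_eq_abs]
    refine (norm_integral_le_of_norm_le ((integral_airyHeat_mul_exp ht x c).1.const_mul
      (C * Real.exp (-y))) (ae_of_all _ fun z => ?_)).trans (le_of_eq ?_)
    · rw [norm_mul, Real.norm_eq_abs, Real.norm_eq_abs, abs_of_nonneg (airyHeat_nonneg _ _ _)]
      calc _ ≤ airyHeat t x z * (C * (Real.exp (-(c * z)) * Real.exp (-y))) :=
            mul_le_mul_of_nonneg_left (h z y) (airyHeat_nonneg _ _ _)
        _ = _ := by ring
    · rw [integral_const_mul, (integral_airyHeat_mul_exp ht x c).2]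
      ring

/-- Associativity, combined with the semigroup law. -/
theorem HasExpBound.kernelMul_airyHeat_kernelMul {k : ℝ → ℝ → ℝ} (hk : HasExpBound k) {t u : ℝ}
    (ht : 0 < t) (hu : 0 < u) :
    kernelMul (airyHeat t) (kernelMul (airyHeat u) k) = kernelMul (airyHeat (t + u)) k := by
  funext x y
  obtain ⟨C, c, hC, hc, h⟩ := hk.bound
  set F : ℝ → ℝ → ℝ := fun z z' => airyHeat t x z * (airyHeat u z z' * k z' y) with hF
  have hmH : Measurable fun p : ℝ × ℝ => airyHeat u p.1 p.2 :=
    (continuous_airyHeat u).measurable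
  have hFi : Integrable (Function.uncurry F) (volume.prod volume) := by
    have hG : Integrable (fun p : ℝ × ℝ => airyHeat t x p.1 *
        (airyHeat u p.1 p.2 * Real.exp (-(c * p.2)))) (volume.prod volume) := by
      refine (integrable_prod_iff ?_).2 ⟨ae_of_all _ fun z =>
        (integral_airyHeat_mul_exp hu z c).1.const_mul (airyHeat t x z), ?_⟩
      · exact (((measurable_airyHeat_left t x).comp measurable_fst).mul
          (hmH.mul (by fun_prop))).aestronglyMeasurable
      · refine ((integral_airyHeat_mul_exp ht x (c + u)).1.const_mul
          (Real.exp (((c + u) ^ 3 - c ^ 3) / 3))).congr (ae_of_all _ fun z => ?_)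
        have hn : ∀ z', ‖airyHeat t x z * (airyHeat u z z' * Real.exp (-(c * z')))‖ =
            airyHeat t x z * (airyHeat u z z' * Real.exp (-(c * z'))) := fun z' =>
          Real.norm_of_nonneg (mul_nonneg (airyHeat_nonneg _ _ _)
            (mul_nonneg (airyHeat_nonneg _ _ _) (Real.exp_pos _).le))
        simp only [hn]
        rw [integral_const_mul, (integral_airyHeat_mul_exp hu z c).2]
        ring
    refine (hG.const_mul (C * Real.exp (-y))).mono' ?_ (ae_of_all _ fun p => ?_)
    · exact (((measurable_airyHeat_left t x).comp measurable_fst).mul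
        (hmH.mul ((hk.measurable_left y).comp measurable_snd))).aestronglyMeasurable
    · simp only [Function.uncurry_def, hF]
      rw [norm_mul, norm_mul, Real.norm_eq_abs, Real.norm_eq_abs, Real.norm_eq_abs,
        abs_of_nonneg (airyHeat_nonneg _ _ _), abs_of_nonneg (airyHeat_nonneg _ _ _)]
      calc _ ≤ airyHeat t x p.1 * (airyHeat u p.1 p.2 *
            (C * (Real.exp (-(c * p.2)) * Real.exp (-y)))) :=
            mul_le_mul_of_nonneg_left (mul_le_mul_of_nonneg_left (h _ _) (airyHeat_nonneg _ _ _))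
              (airyHeat_nonneg _ _ _)
        _ = _ := by ring
  have hswap := integral_integral_swap hFi
  have hL : ∀ z, ∫ z', F z z' = airyHeat t x z * kernelMul (airyHeat u) k z y := fun z => by
    simp only [hF]
    rw [integral_const_mul]
    rfl
  have hR : ∀ z', ∫ z, F z z' = airyHeat (t + u) x z' * k z' y := fun z' => by
    simp only [hF, ← mul_assoc]
    rw [integral_mul_const, ← kernelMul_airyHeat_airyHeat ht hu]
    rfl
  simp_rw [hL, hR] at hswap
  exact hswap

/-- The chain `barChain` without its leftmost projection. -/
def barHat (R : ℝ → ℝ → ℝ) : (m : ℕ) → (w a : Fin (m + 1) → ℝ) → ℝ → ℝ → ℝ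
  | 0, _, _ => R
  | m + 1, w, a => kernelMul (expH (w 0 - w 1)) (barChain R m (Fin.tail w) (Fin.tail a))

theorem barChain_eq_barProj (R : ℝ → ℝ → ℝ) (m : ℕ) (w a : Fin (m + 1) → ℝ) :
    barChain R m w a = barProj (a 0) (barHat R m w a) := by
  cases m <;> rfl

/-- The right ends of the chain: entry `i` is the kernel of
`e^{(w_i - w_{i+1})H} P̄_{a_{i+1}} ⋯ P̄_{a_m} R`. -/
def chainTail (R : ℝ → ℝ → ℝ) : (m : ℕ) → (w a : Fin (m + 1) → ℝ) → Fin (m + 1) → ℝ → ℝ → ℝ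
  | 0, _, _ => fun _ => R
  | m + 1, w, a => Fin.cons (barHat R (m + 1) w a) (chainTail R m (Fin.tail w) (Fin.tail a))

theorem chainTail_zero (R : ℝ → ℝ → ℝ) (m : ℕ) (w a : Fin (m + 1) → ℝ) :
    chainTail R m w a 0 = barHat R m w a := by
  cases m <;> rfl

theorem strictMono_tail {m : ℕ} {w : Fin (m + 2) → ℝ} (hw : StrictMono w) :
    StrictMono (Fin.tail w) := hw.comp Fin.strictMono_succ

theorem expH_sub_eq_airyHeat {u v : ℝ} (h : u < v) : expH (u - v) = airyHeat (v - u) := by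
  rw [← neg_sub v u, expH_eq_airyHeat (sub_pos.2 h)]

theorem hasExpBound_barHat {R : ℝ → ℝ → ℝ} (hR : HasExpBound R) :
    ∀ (m : ℕ) (w a : Fin (m + 1) → ℝ), StrictMono w → HasExpBound (barHat R m w a)
  | 0, _, _, _ => hR
  | m + 1, w, a, hw => by
    have h := hasExpBound_barHat hR m (Fin.tail w) (Fin.tail a) (strictMono_tail hw)
    have h01 := hw (show (0 : Fin (m + 2)) < 1 from Fin.zero_lt_one)
    change HasExpBound (kernelMul (expH (w 0 - w 1)) (barChain R m (Fin.tail w) (Fin.tail a)))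
    rw [expH_sub_eq_airyHeat h01, barChain_eq_barProj]
    exact (h.barProj _).kernelMul_airyHeat (sub_pos.2 h01)

theorem hasExpBound_chainTail {R : ℝ → ℝ → ℝ} (hR : HasExpBound R) :
    ∀ (m : ℕ) (w a : Fin (m + 1) → ℝ), StrictMono w → ∀ i, HasExpBound (chainTail R m w a i)
  | 0, _, _, _, _ => hR
  | m + 1, w, a, hw, i => by
    refine Fin.cases ?_ (fun i => ?_) i
    · rw [chainTail_zero]
      exact hasExpBound_barHat hR _ _ _ hw
    · exact hasExpBound_chainTail hR m _ _ (strictMono_tail hw) i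

theorem barChainConverges {R : ℝ → ℝ → ℝ} (hR : HasExpBound R) :
    ∀ (m : ℕ) (w a : Fin (m + 1) → ℝ), StrictMono w → BarChainConverges R m w a
  | 0, _, _, _ => trivial
  | m + 1, w, a, hw => by
    have h01 := hw (show (0 : Fin (m + 2)) < 1 from Fin.zero_lt_one)
    refine ⟨fun x y => ?_, barChainConverges hR m _ _ (strictMono_tail hw)⟩
    rw [expH_sub_eq_airyHeat h01, barChain_eq_barProj]
    exact ((hasExpBound_barHat hR m _ _ (strictMono_tail hw)).barProj _).integrable_airyHeat_mul
      (sub_pos.2 h01) x y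

/-- Inclusion-exclusion for the chain: writing every `P̄ = 1 - P` and sorting the terms by the first
index `j > i` at which `P` occurs. -/
theorem chainTail_add_sum (b : ℝ) : ∀ (m : ℕ) (w a : Fin (m + 1) → ℝ), StrictMono w →
    HasExpBound (expHK (w (Fin.last m) - b)) → ∀ (i : Fin (m + 1)) (x y : ℝ),
    chainTail (expHK (w (Fin.last m) - b)) m w a i x y +
      ∑ j, (if i < j then kernelMul (airyHeat (w j - w i))
        (upProj (a j) (chainTail (expHK (w (Fin.last m) - b)) m w a j)) x y else 0) =
      expHK (w i - b) x y
  | 0, w, a, _, _, i, x, y => by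
    have hi : i = Fin.last 0 := Subsingleton.elim (α := Fin 1) _ _
    subst hi
    simp [chainTail]
  | m + 1, w, a, hw, hR, i, x, y => by
    have hw' := strictMono_tail hw
    have h01 := sub_pos.2 (hw (show (0 : Fin (m + 2)) < 1 from Fin.zero_lt_one))
    have ih := chainTail_add_sum b m (Fin.tail w) (Fin.tail a) hw' hR
    set R := expHK (w (Fin.last (m + 1)) - b) with hRdef
    have hRtail : expHK (Fin.tail w (Fin.last m) - b) = R := rfl
    rw [hRtail] at ih
    set h' := chainTail R m (Fin.tail w) (Fin.tail a) with hh'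
    have hb : ∀ j, HasExpBound (upProj (Fin.tail a j) (h' j)) := fun j =>
      (hasExpBound_chainTail hR m _ _ hw' j).upProj _
    have hsucc : ∀ j : Fin (m + 1), chainTail R (m + 1) w a j.succ = h' j := fun j => rfl
    rw [Fin.sum_univ_succ]
    simp only [hsucc]
    rcases Fin.eq_zero_or_eq_succ i with rfl | ⟨i, rfl⟩
    · simp only [lt_self_iff_false, if_false, Fin.succ_pos, if_true, zero_add]
      have h1 : chainTail R (m + 1) w a 0 =
          kernelMul (airyHeat (w 1 - w 0)) (barProj (Fin.tail a 0) (h' 0)) := by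
        rw [chainTail_zero, hh', chainTail_zero, ← barChain_eq_barProj,
          ← expH_sub_eq_airyHeat (sub_pos.1 h01)]
        rfl
      -- apply the first heat kernel to the identity of the shorter chain
      have h2 : expHK (w 0 - b) x y = ∫ z, airyHeat (w 1 - w 0) x z *
          (barProj (Fin.tail a 0) (h' 0) z y + upProj (Fin.tail a 0) (h' 0) z y +
            ∑ j, (if 0 < j then kernelMul (airyHeat (Fin.tail w j - Fin.tail w 0))
              (upProj (Fin.tail a j) (h' j)) z y else 0)) := by
        have h3 := kernelMul_airyHeat_expHK h01 (w 1 - b)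
        rw [show w 1 - b - (w 1 - w 0) = w 0 - b by ring] at h3
        rw [← h3]
        unfold kernelMul
        congr 1
        funext z
        rw [barProj_add_upProj]
        congr 1
        exact (ih 0 z y).symm
      have hj : ∀ j : Fin (m + 1), 0 < j → 0 < Fin.tail w j - Fin.tail w 0 := fun j h =>
        sub_pos.2 (hw' h)
      have hi1 : Integrable fun z => airyHeat (w 1 - w 0) x z *
          barProj (Fin.tail a 0) (h' 0) z y :=
        ((hasExpBound_chainTail hR m (Fin.tail w) (Fin.tail a) hw' 0).barProj
          (Fin.tail a 0)).integrable_airyHeat_mul h01 x y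
      have hi2 : Integrable fun z => airyHeat (w 1 - w 0) x z *
          upProj (Fin.tail a 0) (h' 0) z y := (hb 0).integrable_airyHeat_mul h01 x y
      have hi12 : Integrable fun z => airyHeat (w 1 - w 0) x z * barProj (Fin.tail a 0) (h' 0) z y +
          airyHeat (w 1 - w 0) x z * upProj (Fin.tail a 0) (h' 0) z y := hi1.add hi2
      have hi3 : ∀ j : Fin (m + 1), Integrable fun z => airyHeat (w 1 - w 0) x z *
          (if 0 < j then kernelMul (airyHeat (Fin.tail w j - Fin.tail w 0))
              (upProj (Fin.tail a j) (h' j)) z y else 0) := fun j => by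
        split_ifs with h
        · exact ((hb j).kernelMul_airyHeat (hj j h)).integrable_airyHeat_mul h01 x y
        · simp
      simp only [mul_add, Finset.mul_sum] at h2
      rw [integral_add hi12 (integrable_finsetSum _ fun j _ => hi3 j),
        integral_add hi1 hi2, integral_finsetSum _ fun j _ => hi3 j] at h2
      rw [h2, h1]
      refine Eq.trans ?_ (add_assoc (_ : ℝ) _ _).symm
      congr 1
      have h4 : ∀ j : Fin (m + 1), kernelMul (airyHeat (w j.succ - w 0))
          (upProj (a j.succ) (h' j)) x y =
          (if j = 0 then kernelMul (airyHeat (w 1 - w 0)) (upProj (Fin.tail a 0) (h' 0)) x y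
            else 0) + ∫ z, airyHeat (w 1 - w 0) x z *
            (if 0 < j then kernelMul (airyHeat (Fin.tail w j - Fin.tail w 0))
              (upProj (Fin.tail a j) (h' j)) z y else 0) := by
        intro j
        by_cases hj0 : j = 0
        · subst hj0
          simp only [lt_self_iff_false, if_false, if_true, mul_zero, integral_zero, add_zero]
          rfl
        · have hjp : 0 < j := Fin.pos_iff_ne_zero.2 hj0
          simp only [hj0, hjp, if_false, if_true, zero_add]
          have h5 := (hb j).kernelMul_airyHeat_kernelMul h01 (hj j hjp)
          rw [show w 1 - w 0 + (Fin.tail w j - Fin.tail w 0) = w j.succ - w 0 by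
            simp only [Fin.tail, Fin.succ_zero_eq_one]; ring] at h5
          exact (congrFun (congrFun h5 x) y).symm
      simp only [h4]
      rw [Finset.sum_add_distrib, Finset.sum_ite_eq' Finset.univ (0 : Fin (m + 1)),
        if_pos (Finset.mem_univ _)]
      rfl
    · simp only [hsucc, Fin.succ_lt_succ_iff, Fin.not_lt_zero, if_false, zero_add]
      exact ih i x y

/-! ### Block kernels on `L²({0, …, m} × ℝ)` -/

instance sigmaFinite_matrixMeasure (n : ℕ) : SigmaFinite (matrixMeasure n) := by
  unfold matrixMeasure
  infer_instance

theorem integral_matrixMeasure {n : ℕ} {f : Fin n × ℝ → ℝ} (hf : Integrable f (matrixMeasure n)) :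
    ∫ p, f p ∂(matrixMeasure n) = ∑ i, ∫ x, f (i, x) := by
  unfold matrixMeasure at hf ⊢
  rw [integral_prod _ hf, integral_countable hf.integral_prod_left, tsum_fintype]
  simp [Measure.real]

theorem integrable_matrixMeasure {n : ℕ} {f : Fin n × ℝ → ℝ} (hm : Measurable f)
    (hf : ∀ i, Integrable fun x => f (i, x)) : Integrable f (matrixMeasure n) := by
  unfold matrixMeasure
  exact (integrable_prod_iff hm.aestronglyMeasurable).2 ⟨ae_of_all _ hf, Integrable.of_finite⟩

theorem measurable_block {n : ℕ} {f : Fin n → ℝ → ℝ} (hf : ∀ i, Measurable (f i)) :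
    Measurable fun p : Fin n × ℝ => f p.1 p.2 :=
  measurable_from_prod_countable_right hf

theorem measurable_blockKernel {n : ℕ} {k : Fin n → Fin n → ℝ → ℝ → ℝ}
    (hk : ∀ i j, Measurable (Function.uncurry (k i j))) :
    Measurable (Function.uncurry fun p q : Fin n × ℝ => k p.1 q.1 p.2 q.2) := by
  have h1 : Measurable fun r : (Fin n × Fin n) × (ℝ × ℝ) => k r.1.1 r.1.2 r.2.1 r.2.2 :=
    measurable_from_prod_countable_right fun ij => hk ij.1 ij.2
  exact h1.comp (by fun_prop : Measurable fun r : (Fin n × ℝ) × (Fin n × ℝ) =>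
    ((r.1.1, r.2.1), (r.1.2, r.2.2)))

theorem exists_isDominated_blockKernel {n : ℕ} {φ ψ : Fin n × ℝ → ℝ} (hφ : ∀ p, 0 ≤ φ p)
    (hψ : ∀ p, 0 ≤ ψ p) {k : Fin n → Fin n → ℝ → ℝ → ℝ}
    (hk : ∀ i j, Measurable (Function.uncurry (k i j)))
    (hb : ∀ i j, ∃ C, 0 ≤ C ∧ ∀ x y, |k i j x y| ≤ C * (φ (i, x) * ψ (j, y))) :
    ∃ C, 0 ≤ C ∧ IsDominated φ ψ C fun p q => k p.1 q.1 p.2 q.2 := by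
  choose C hC h using hb
  refine ⟨∑ i, ∑ j, C i j, Finset.sum_nonneg fun i _ => Finset.sum_nonneg fun j _ => hC i j,
    measurable_blockKernel hk, fun p q => (h p.1 q.1 p.2 q.2).trans ?_⟩
  refine mul_le_mul_of_nonneg_right ?_ (mul_nonneg (hφ _) (hψ _))
  calc C p.1 q.1 ≤ ∑ j, C p.1 j :=
        Finset.single_le_sum (f := fun j => C p.1 j) (fun j _ => hC _ j) (Finset.mem_univ _)
    _ ≤ _ := Finset.single_le_sum (f := fun i => ∑ j, C i j)
        (fun i _ => Finset.sum_nonneg fun j _ => hC i j) (Finset.mem_univ _)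

/-! ### The weights -/

/-- The weight of the rows. It decays at both ends in block `0`, which is a whole line, and is
supported on `[a_i, ∞)` in the other blocks. -/
def rowWeight {m : ℕ} (a : Fin (m + 1) → ℝ) (p : Fin (m + 1) × ℝ) : ℝ :=
  if p.1 = 0 then Real.exp (-(2 * |p.2|))
  else if a p.1 ≤ p.2 then Real.exp (-(2 * p.2)) else 0

/-- The weight of the columns; `δ` is a lower bound of the differences of the `w_i`. -/
def colWeight {m : ℕ} (δ : ℝ) (p : Fin (m + 1) × ℝ) : ℝ :=
  if p.1 = 0 then Real.exp (-p.2) else Real.exp ((2 - δ) * p.2)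

theorem rowWeight_nonneg {m : ℕ} (a : Fin (m + 1) → ℝ) (p : Fin (m + 1) × ℝ) :
    0 ≤ rowWeight a p := by
  unfold rowWeight
  split_ifs <;> positivity

theorem colWeight_nonneg {m : ℕ} (δ : ℝ) (p : Fin (m + 1) × ℝ) : 0 ≤ colWeight δ p := by
  unfold colWeight
  split_ifs <;> positivity

theorem integrable_rowWeight_mul_colWeight_zero :
    Integrable fun x : ℝ => Real.exp (-(2 * |x|)) * Real.exp (-x) := by
  refine (integrable_exp_neg_mul_abs one_pos).mono' (by fun_prop) (ae_of_all _ fun x => ?_)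
  rw [Real.norm_eq_abs, abs_of_pos (by positivity), ← Real.exp_add]
  apply Real.exp_le_exp.2
  linarith [neg_abs_le x]

theorem isWeightPair_rowWeight_colWeight {m : ℕ} (a : Fin (m + 1) → ℝ) {δ : ℝ} (hδ : 0 < δ) :
    IsWeightPair (matrixMeasure (m + 1)) (rowWeight a) (colWeight δ) := by
  refine ⟨rowWeight_nonneg a, colWeight_nonneg δ, integrable_matrixMeasure ?_ fun i => ?_⟩
  · refine measurable_block (f := fun i x => rowWeight a (i, x) * colWeight δ (i, x)) fun i => ?_
    unfold rowWeight colWeight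
    refine Measurable.mul ?_ ?_
    · simp only
      split_ifs
      · fun_prop
      · exact Measurable.ite measurableSet_Ici (by fun_prop) measurable_const
    · simp only
      split_ifs <;> fun_prop
  · by_cases hi : i = 0
    · simp only [rowWeight, colWeight, hi, if_true]
      exact integrable_rowWeight_mul_colWeight_zero
    · simp only [rowWeight, colWeight, hi, if_false]
      have h1 : Integrable ((Set.Ici (a i)).indicator fun x => Real.exp (-δ * x)) :=
        (integrable_indicator_iff measurableSet_Ici).2
          ((integrableOn_Ici_iff_integrableOn_Ioi (by simp)).2
            (integrableOn_exp_mul_Ioi (neg_lt_zero.2 hδ) _))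
      refine h1.congr (ae_of_all _ fun x => ?_)
      by_cases hx : a i ≤ x
      · simp only [hx, if_true]
        rw [Set.indicator_of_mem (by exact hx), ← Real.exp_add]
        congr 1
        ring
      · simp only [hx, if_false]
        rw [Set.indicator_of_notMem (by exact hx), zero_mul]

theorem exists_exp_le_rowWeight {m : ℕ} (a : Fin (m + 1) → ℝ) (i : Fin (m + 1)) {c : ℝ}
    (hc : 2 ≤ c) :
    ∃ D, 0 ≤ D ∧ ∀ x, a i ≤ x → Real.exp (-(c * x)) ≤ D * rowWeight a (i, x) := by
  refine ⟨Real.exp ((c + 2) * |a i|), by positivity, fun x hx => ?_⟩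
  have h1 : -|a i| ≤ x := (neg_abs_le _).trans hx
  have h2 := abs_nonneg (a i)
  unfold rowWeight
  simp only [hx, if_true]
  split_ifs
  · rw [← Real.exp_add]
    apply Real.exp_le_exp.2
    rcases le_total 0 x with h | h
    · rw [abs_of_nonneg h]; nlinarith
    · rw [abs_of_nonpos h]; nlinarith
  · rw [← Real.exp_add]
    apply Real.exp_le_exp.2
    nlinarith

theorem exists_exp_le_colWeight {m : ℕ} (a : Fin (m + 1) → ℝ) {j : Fin (m + 1)} (hj : j ≠ 0)
    {δ c : ℝ} (hc : c ≤ 2 - δ) :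
    ∃ D, 0 ≤ D ∧ ∀ y, a j ≤ y → Real.exp (c * y) ≤ D * colWeight δ (j, y) := by
  refine ⟨Real.exp ((c - (2 - δ)) * a j), by positivity, fun y hy => ?_⟩
  simp only [colWeight, hj, if_false]
  rw [← Real.exp_add]
  apply Real.exp_le_exp.2
  nlinarith

theorem mul_le_of_le_weights {A B C D D' φ ψ : ℝ} (hA : 0 ≤ A) (hB : 0 ≤ B) (hC : 0 ≤ C)
    (h1 : A ≤ D * φ) (h2 : B ≤ D' * ψ) : C * (A * B) ≤ C * D * D' * (φ * ψ) := by
  calc C * (A * B) ≤ C * ((D * φ) * (D' * ψ)) :=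
        mul_le_mul_of_nonneg_left (mul_le_mul h1 h2 hB (hA.trans h1)) hC
    _ = _ := by ring

section

variable {m : ℕ} {w : Fin (m + 1) → ℝ} (a : Fin (m + 1) → ℝ) {δ : ℝ}

theorem exists_abs_expHK_le_weights (hw : StrictMono w) (hδ : 0 < δ) (i j : Fin (m + 1)) :
    ∃ C, 0 ≤ C ∧ ∀ x y, a i ≤ x → (j = 0 ∨ a j ≤ y) →
      |expHK (w i - w j) x y| ≤ C * (rowWeight a (i, x) * colWeight δ (j, y)) := by
  obtain ⟨D, hD, h1⟩ := exists_exp_le_rowWeight a i le_rfl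
  by_cases hj : j = 0
  · subst hj
    have hs : 0 ≤ w i - w 0 := sub_nonneg.2 (hw.monotone (Fin.zero_le i))
    obtain ⟨C, hC, h⟩ := exists_abs_expHK_le (r := 2) (r' := 1) (s := w i - w 0) two_pos one_pos
      (by linarith)
    refine ⟨C * D * 1, by positivity, fun x y hx _ => (h x y).trans ?_⟩
    refine mul_le_of_le_weights (by positivity) (by positivity) hC (h1 x hx) (le_of_eq ?_)
    simp [colWeight]
  · have hr' : 0 < |w i - w j| + δ + 1 := by positivity
    obtain ⟨C, hC, h⟩ := exists_abs_expHK_le (r := 2) (s := w i - w j) two_pos hr'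
      (by linarith [neg_abs_le (w i - w j)])
    obtain ⟨D', hD', h2⟩ := exists_exp_le_colWeight a hj (δ := δ)
      (c := -(|w i - w j| + δ + 1)) (by linarith [abs_nonneg (w i - w j)])
    refine ⟨C * D * D', by positivity, fun x y hx hy => (h x y).trans ?_⟩
    refine mul_le_of_le_weights (by positivity) (by positivity) hC (h1 x hx) ?_
    rw [← neg_mul]
    exact h2 y (hy.resolve_left hj)

theorem exists_airyHeat_le_weights (hδ : ∀ i j, i < j → δ ≤ w j - w i) (hδ0 : 0 < δ)
    {i j : Fin (m + 1)} (hij : i < j) :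
    ∃ C, 0 ≤ C ∧ ∀ x y, (i = 0 ∨ a i ≤ x) → a j ≤ y →
      airyHeat (w j - w i) x y ≤ C * (rowWeight a (i, x) * colWeight δ (j, y)) := by
  have hj : j ≠ 0 := ((Fin.zero_le i).trans_lt hij).ne'
  have ht := hδ i j hij
  have ht0 : 0 < w j - w i := hδ0.trans_le ht
  obtain ⟨C₁, hC₁, b₁⟩ := exists_airyHeat_le ht0 2
  obtain ⟨D₁, hD₁, d₁⟩ := exists_exp_le_colWeight a hj (δ := δ) (c := 2 - (w j - w i))
    (by linarith)
  by_cases hi : i = 0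
  · subst hi
    obtain ⟨C₂, hC₂, b₂⟩ := exists_airyHeat_le ht0 (-2)
    obtain ⟨D₂, hD₂, d₂⟩ := exists_exp_le_colWeight a hj (δ := δ) (c := -2 - (w j - w 0))
      (by linarith)
    refine ⟨C₁ * 1 * D₁ + C₂ * 1 * D₂, by positivity, fun x y _ hy => ?_⟩
    have hnn := mul_nonneg (rowWeight_nonneg a (0, x)) (colWeight_nonneg δ (j, y))
    rcases le_total 0 x with hx | hx
    · refine (b₁ x y).trans ((mul_le_of_le_weights (by positivity) (by positivity) hC₁
        (le_of_eq ?_) (d₁ y hy)).trans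
          (mul_le_mul_of_nonneg_right (le_add_of_nonneg_right (by positivity)) hnn))
      simp [rowWeight, abs_of_nonneg hx]
    · refine (b₂ x y).trans ((mul_le_of_le_weights (by positivity) (by positivity) hC₂
        (le_of_eq ?_) (d₂ y hy)).trans
          (mul_le_mul_of_nonneg_right (le_add_of_nonneg_left (by positivity)) hnn))
      simp [rowWeight, abs_of_nonpos hx]
  · obtain ⟨D, hD, h1⟩ := exists_exp_le_rowWeight a i le_rfl
    refine ⟨C₁ * D * D₁, by positivity, fun x y hx hy => (b₁ x y).trans ?_⟩
    exact mul_le_of_le_weights (by positivity) (by positivity) hC₁ (h1 x (hx.resolve_left hi))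
      (d₁ y hy)

theorem HasExpBound.exists_abs_le_weights {k : ℝ → ℝ → ℝ} (hk : HasExpBound k)
    (i : Fin (m + 1)) :
    ∃ C, 0 ≤ C ∧ ∀ x y, a i ≤ x →
      |k x y| ≤ C * (rowWeight a (i, x) * colWeight δ ((0 : Fin (m + 1)), y)) := by
  obtain ⟨C, c, hC, hc, h⟩ := hk.bound
  obtain ⟨D, hD, h1⟩ := exists_exp_le_rowWeight a i hc
  refine ⟨C * D * 1, by positivity, fun x y hx => (h x y).trans ?_⟩
  refine mul_le_of_le_weights (by positivity) (by positivity) hC (h1 x hx) (le_of_eq ?_)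
  simp [colWeight]

end

/-! ### The extended kernel and the two column operations -/

/-- The operator with blocks `k i j`, as a kernel on `{0, …, m} × ℝ`. -/
def blockKernel {n : ℕ} (k : Fin n → Fin n → ℝ → ℝ → ℝ) (p q : Fin n × ℝ) : ℝ :=
  k p.1 q.1 p.2 q.2

/-- The strictly upper triangular part: the kernel of `e^{(w_i - w_j)H}` for `i < j`. -/
def upperBlock {n : ℕ} (w : Fin n → ℝ) (i j : Fin n) (x y : ℝ) : ℝ :=
  if i < j then airyHeat (w j - w i) x y else 0

/-- The extended Airy kernel with strict inequalities in the projections, and without the projection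
on the right in the columns of block `0`. -/
def extendedBlock {m : ℕ} (w a : Fin (m + 1) → ℝ) (i j : Fin (m + 1)) (x y : ℝ) : ℝ :=
  if a i < x ∧ (j = 0 ∨ a j < y) then expHK (w i - w j) x y - upperBlock w i j x y else 0

/-- The first column operation `-e^{(w_0 - w_j)H} P_{a_j}`, from block `j ≠ 0` to block `0`. -/
def shearBlock {m : ℕ} (w a : Fin (m + 1) → ℝ) (i j : Fin (m + 1)) (x y : ℝ) : ℝ :=
  if i = 0 ∧ a j < y then -upperBlock w i j x y else 0

/-- The kernel after the first column operation: `e^{(w_i - w_j)H} K` is left in column `0` only. -/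
def shearedBlock {m : ℕ} (w a : Fin (m + 1) → ℝ) (i j : Fin (m + 1)) (x y : ℝ) : ℝ :=
  if j = 0 then (if a i < x then expHK (w i - w 0) x y else 0)
  else if a j < y then
    (if i = 0 then 1 else 0) * upperBlock w i j x y - (if a i < x then upperBlock w i j x y else 0)
  else 0

/-- The second column operation, from block `0` to the blocks `i ≠ 0`: the tails of the chain. -/
def tailBlock {m : ℕ} (w a : Fin (m + 1) → ℝ) (i j : Fin (m + 1)) (x y : ℝ) : ℝ :=
  if i ≠ 0 ∧ j = 0 then
    upProj (a i) (chainTail (expHK (w (Fin.last m) - w 0)) m w a i) x y else 0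

theorem opMul_blockKernel {n : ℕ} {φ ψ : Fin n × ℝ → ℝ} {C C' : ℝ}
    (hw : IsWeightPair (matrixMeasure n) φ ψ) {k N : Fin n → Fin n → ℝ → ℝ → ℝ}
    (hk : IsDominated φ ψ C (blockKernel k)) (hN : IsDominated φ ψ C' (blockKernel N))
    (i j : Fin n) (x y : ℝ) :
    opMul (matrixMeasure n) (blockKernel k) (blockKernel N) (i, x) (j, y) =
      ∑ l, ∫ z, k i l x z * N l j z y :=
  integral_matrixMeasure (hk.integrable_mul hw hN (i, x) (j, y))

theorem measurable_upperBlock {n : ℕ} (w : Fin n → ℝ) (i j : Fin n) :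
    Measurable (Function.uncurry (upperBlock w i j)) := by
  unfold upperBlock
  split_ifs
  · exact (continuous_airyHeat _).measurable
  · exact measurable_const

theorem measurable_expHK (s : ℝ) : Measurable (Function.uncurry (expHK s)) :=
  measurable_spectralKernel (isAdmissibleSymbol_expNegSymbol s).measurable

theorem expHK_zero : expHK 0 = airyKernel := airyKernel_eq_spectralKernel.symm

theorem extendedEntry_eq {m : ℕ} {w : Fin (m + 1) → ℝ} (a : Fin (m + 1) → ℝ) (hw : StrictMono w)
    (i j : Fin (m + 1)) (x y : ℝ) :
    extendedEntry w a i j x y =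
      if a i ≤ x ∧ a j ≤ y then expHK (w i - w j) x y - upperBlock w i j x y else 0 := by
  unfold extendedEntry upperBlock
  congr 1
  by_cases h : j ≤ i
  · rw [if_pos h, if_neg (not_lt.2 h), sub_zero]
  · have hij := not_le.1 h
    have h1 := expHOneSubK_eq (sub_pos.2 (hw hij)) x y
    rw [neg_sub] at h1
    rw [if_neg h, if_pos hij, h1]
    ring

section

variable {m : ℕ} {w : Fin (m + 1) → ℝ} (a : Fin (m + 1) → ℝ) {δ : ℝ}

theorem exists_abs_upperBlock_le_weights (hδ : ∀ i j, i < j → δ ≤ w j - w i) (hδ0 : 0 < δ)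
    (i j : Fin (m + 1)) :
    ∃ C, 0 ≤ C ∧ ∀ x y, (i = 0 ∨ a i ≤ x) → (j = 0 ∨ a j ≤ y) →
      |upperBlock w i j x y| ≤ C * (rowWeight a (i, x) * colWeight δ (j, y)) := by
  unfold upperBlock
  by_cases hij : i < j
  · obtain ⟨C, hC, h⟩ := exists_airyHeat_le_weights a hδ hδ0 hij
    refine ⟨C, hC, fun x y hx hy => ?_⟩
    rw [if_pos hij, abs_of_nonneg (airyHeat_nonneg _ _ _)]
    exact h x y hx (hy.resolve_left ((Fin.zero_le i).trans_lt hij).ne')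
  · refine ⟨0, le_rfl, fun x y _ _ => ?_⟩
    rw [if_neg hij, abs_zero, zero_mul]

theorem exists_abs_sub_le_weights (hw : StrictMono w) (hδ : ∀ i j, i < j → δ ≤ w j - w i)
    (hδ0 : 0 < δ) (i j : Fin (m + 1)) :
    ∃ C, 0 ≤ C ∧ ∀ x y, a i ≤ x → (j = 0 ∨ a j ≤ y) →
      |expHK (w i - w j) x y - upperBlock w i j x y| ≤
        C * (rowWeight a (i, x) * colWeight δ (j, y)) := by
  obtain ⟨C₁, hC₁, h₁⟩ := exists_abs_expHK_le_weights a hw hδ0 i j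
  obtain ⟨C₂, hC₂, h₂⟩ := exists_abs_upperBlock_le_weights a hδ hδ0 i j
  refine ⟨C₁ + C₂, by positivity, fun x y hx hy => ?_⟩
  rw [add_mul]
  exact (abs_sub _ _).trans (add_le_add (h₁ x y hx hy) (h₂ x y (Or.inr hx) hy))

theorem exists_isDominated_extendedAiryKernel (hw : StrictMono w)
    (hδ : ∀ i j, i < j → δ ≤ w j - w i) (hδ0 : 0 < δ) :
    ∃ C, 0 ≤ C ∧ IsDominated (rowWeight a) (colWeight δ) C (extendedAiryKernel w a) := by
  have heq : extendedAiryKernel w a = fun p q =>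
      if a p.1 ≤ p.2 ∧ a q.1 ≤ q.2 then
        expHK (w p.1 - w q.1) p.2 q.2 - upperBlock w p.1 q.1 p.2 q.2 else 0 := by
    funext p q
    exact extendedEntry_eq a hw _ _ _ _
  rw [heq]
  refine exists_isDominated_blockKernel (rowWeight_nonneg a) (colWeight_nonneg δ)
    (k := fun i j x y =>
      if a i ≤ x ∧ a j ≤ y then expHK (w i - w j) x y - upperBlock w i j x y else 0)
    (fun i j => ?_) (fun i j => ?_)
  · exact Measurable.ite ((measurableSet_le measurable_const measurable_fst).inter
      (measurableSet_le measurable_const measurable_snd))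
      ((measurable_expHK _).sub (measurable_upperBlock w i j)) measurable_const
  · obtain ⟨C, hC, h⟩ := exists_abs_sub_le_weights a hw hδ hδ0 i j
    refine ⟨C, hC, fun x y => ?_⟩
    split_ifs with hxy
    · exact h x y hxy.1 (Or.inr hxy.2)
    · rw [abs_zero]
      exact mul_nonneg hC (mul_nonneg (rowWeight_nonneg _ _) (colWeight_nonneg _ _))

theorem exists_isDominated_extendedBlock (hw : StrictMono w)
    (hδ : ∀ i j, i < j → δ ≤ w j - w i) (hδ0 : 0 < δ) :
    ∃ C, 0 ≤ C ∧ IsDominated (rowWeight a) (colWeight δ) C (blockKernel (extendedBlock w a)) := by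
  refine exists_isDominated_blockKernel (rowWeight_nonneg a) (colWeight_nonneg δ)
    (fun i j => ?_) (fun i j => ?_)
  · exact Measurable.ite ((measurableSet_lt measurable_const measurable_fst).inter
      ((MeasurableSet.const _).union (measurableSet_lt measurable_const measurable_snd)))
      ((measurable_expHK _).sub (measurable_upperBlock w i j)) measurable_const
  · obtain ⟨C, hC, h⟩ := exists_abs_sub_le_weights a hw hδ hδ0 i j
    refine ⟨C, hC, fun x y => ?_⟩
    unfold extendedBlock
    split_ifs with hxy
    · exact h x y hxy.1.le (hxy.2.imp_right le_of_lt)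
    · rw [abs_zero]
      exact mul_nonneg hC (mul_nonneg (rowWeight_nonneg _ _) (colWeight_nonneg _ _))

theorem exists_isDominated_shearBlock (hδ : ∀ i j, i < j → δ ≤ w j - w i) (hδ0 : 0 < δ) :
    ∃ C, 0 ≤ C ∧ IsDominated (rowWeight a) (colWeight δ) C (blockKernel (shearBlock w a)) := by
  refine exists_isDominated_blockKernel (rowWeight_nonneg a) (colWeight_nonneg δ)
    (fun i j => ?_) (fun i j => ?_)
  · exact Measurable.ite ((MeasurableSet.const _).inter
      (measurableSet_lt measurable_const measurable_snd))
      (measurable_upperBlock w i j).neg measurable_const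
  · obtain ⟨C, hC, h⟩ := exists_abs_upperBlock_le_weights a hδ hδ0 i j
    refine ⟨C, hC, fun x y => ?_⟩
    unfold shearBlock
    split_ifs with hxy
    · rw [abs_neg]
      exact h x y (Or.inl hxy.1) (Or.inr hxy.2.le)
    · rw [abs_zero]
      exact mul_nonneg hC (mul_nonneg (rowWeight_nonneg _ _) (colWeight_nonneg _ _))

theorem exists_isDominated_tailBlock (hw : StrictMono w) :
    ∃ C, 0 ≤ C ∧ IsDominated (rowWeight a) (colWeight δ) C (blockKernel (tailBlock w a)) := by
  have hR : HasExpBound (expHK (w (Fin.last m) - w 0)) :=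
    hasExpBound_expHK (sub_nonneg.2 (hw.monotone (Fin.zero_le _)))
  have hb := hasExpBound_chainTail hR m w a hw
  refine exists_isDominated_blockKernel (rowWeight_nonneg a) (colWeight_nonneg δ)
    (fun i j => ?_) (fun i j => ?_)
  · exact Measurable.ite (MeasurableSet.const _) ((hb i).upProj (a i)).measurable measurable_const
  · obtain ⟨C, hC, h⟩ := (hb i).exists_abs_le_weights (δ := δ) a i
    refine ⟨C, hC, fun x y => ?_⟩
    unfold tailBlock upProj
    split_ifs with hij hx
    · rw [hij.2]
      exact h x y hx.le
    all_goals
      rw [abs_zero]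
      exact mul_nonneg hC (mul_nonneg (rowWeight_nonneg _ _) (colWeight_nonneg _ _))

end

theorem matrixMeasure_graph {n : ℕ} (a : Fin n → ℝ) : matrixMeasure n {p | p.2 = a p.1} = 0 := by
  have hm : MeasurableSet {p : Fin n × ℝ | p.2 = a p.1} :=
    measurableSet_eq_fun measurable_snd ((measurable_of_finite a).comp measurable_fst)
  unfold matrixMeasure
  rw [Measure.measure_prod_null hm]
  refine ae_of_all _ fun i => ?_
  have : Prod.mk i ⁻¹' {p : Fin n × ℝ | p.2 = a p.1} = {a i} := by
    ext x
    simp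
  change volume (Prod.mk i ⁻¹' _) = 0
  rw [this]
  simp

theorem fredholmDet_extendedAiryKernel_eq {m : ℕ} {w : Fin (m + 1) → ℝ} (a : Fin (m + 1) → ℝ)
    (hw : StrictMono w) :
    fredholmDet (matrixMeasure (m + 1)) (extendedAiryKernel w a) =
      fredholmDet (matrixMeasure (m + 1)) (blockKernel (extendedBlock w a)) := by
  refine fredholmDet_congr_of_rows {p | p.2 = a p.1} {p | a p.1 < p.2} (matrixMeasure_graph a)
    (fun p hpZ hp q _ => ?_) (fun p _ hp q _ => ?_) (fun p _ q _ hp hq => ?_)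
  · unfold extendedAiryKernel
    rw [extendedEntry_eq a hw, if_neg]
    exact fun h => hp (lt_of_le_of_ne h.1 fun e => hpZ e.symm)
  · exact if_neg fun h => hp h.1
  · unfold extendedAiryKernel blockKernel extendedBlock
    rw [extendedEntry_eq a hw, if_pos ⟨le_of_lt hp, le_of_lt hq⟩, if_pos ⟨hp, Or.inr hq⟩]

section

variable {m : ℕ} {w : Fin (m + 1) → ℝ} (a : Fin (m + 1) → ℝ) {φ ψ : Fin (m + 1) × ℝ → ℝ} {C C' : ℝ}

theorem blockKernel_shearedBlock_eq (hw : StrictMono w)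
    (hφψ : IsWeightPair (matrixMeasure (m + 1)) φ ψ)
    (hk : IsDominated φ ψ C (blockKernel (extendedBlock w a)))
    (hN : IsDominated φ ψ C' (blockKernel (shearBlock w a))) :
    (fun p q => blockKernel (extendedBlock w a) p q - blockKernel (shearBlock w a) p q +
      opMul (matrixMeasure (m + 1)) (blockKernel (extendedBlock w a))
        (blockKernel (shearBlock w a)) p q) = blockKernel (shearedBlock w a) := by
  funext ⟨i, x⟩ ⟨j, y⟩
  rw [opMul_blockKernel hφψ hk hN]
  simp only [blockKernel]
  -- the product only passes through block `0`, where it is `e^{(w_i - w_j)H} K`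
  have hsum : ∑ l, ∫ z, extendedBlock w a i l x z * shearBlock w a l j z y =
      if j ≠ 0 ∧ a i < x ∧ a j < y then -expHK (w i - w j) x y else 0 := by
    rw [Finset.sum_eq_single 0]
    · by_cases h : j ≠ 0 ∧ a i < x ∧ a j < y
      · have h0j : 0 < j := Fin.pos_iff_ne_zero.2 h.1
        have h1 := congrFun (congrFun
          (kernelMul_expHK_airyHeat (sub_pos.2 (hw h0j)) (w i - w 0)) x) y
        rw [show w i - w 0 - (w j - w 0) = w i - w j by ring] at h1
        rw [if_pos h, ← h1]
        unfold kernelMul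
        rw [← integral_neg]
        congr 1
        funext z
        unfold extendedBlock shearBlock upperBlock
        simp [h.2.1, h.2.2, h0j]
      · rw [if_neg h]
        refine integral_eq_zero_of_ae (ae_of_all _ fun z => ?_)
        simp only [Pi.zero_apply, mul_eq_zero]
        by_contra! hne
        refine h ⟨fun hj => hne.2 ?_, ?_, ?_⟩
        · simp [shearBlock, upperBlock, hj]
        · by_contra hx
          exact hne.1 (if_neg fun h' => hx h'.1)
        · by_contra hy
          exact hne.2 (if_neg fun h' => hy h'.2)
    · intro l _ hl
      simp [shearBlock, hl]
    · simp
  rw [hsum]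
  unfold extendedBlock shearBlock shearedBlock
  by_cases hj : j = 0
  · subst hj
    simp [upperBlock]
  · rcases eq_or_ne i 0 with rfl | hi
    · by_cases hy : a j < y <;> by_cases hx : a 0 < x <;> simp [hj, hy, hx]
    · by_cases hy : a j < y <;> by_cases hx : a i < x <;> simp [hj, hy, hx, hi]
      ring

/-- The kernel after both column operations, in the columns of block `0`. -/
theorem eliminated_col_zero (hw : StrictMono w)
    (hφψ : IsWeightPair (matrixMeasure (m + 1)) φ ψ)
    (hk : IsDominated φ ψ C (blockKernel (shearedBlock w a)))
    (hN : IsDominated φ ψ C' (blockKernel (tailBlock w a))) (i : Fin (m + 1)) (x y : ℝ) :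
    blockKernel (shearedBlock w a) (i, x) (0, y) - blockKernel (tailBlock w a) (i, x) (0, y) +
      opMul (matrixMeasure (m + 1)) (blockKernel (shearedBlock w a))
        (blockKernel (tailBlock w a)) (i, x) (0, y) =
      if i = 0 then scalarKernel w a x y else 0 := by
  rw [opMul_blockKernel hφψ hk hN]
  simp only [blockKernel]
  set R := expHK (w (Fin.last m) - w 0) with hR
  have hRb : HasExpBound R := hasExpBound_expHK (sub_nonneg.2 (hw.monotone (Fin.zero_le _)))
  have hchain := chainTail_add_sum (w 0) m w a hw hRb i x y
  have hsum : ∑ l, ∫ z, shearedBlock w a i l x z * tailBlock w a l 0 z y =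
      ((if i = 0 then 1 else 0) - (if a i < x then 1 else 0)) *
        ∑ l, (if i < l then
          kernelMul (airyHeat (w l - w i)) (upProj (a l) (chainTail R m w a l)) x y
          else 0) := by
    rw [Finset.mul_sum]
    refine Finset.sum_congr rfl fun l _ => ?_
    by_cases hl : l = 0
    · subst hl
      simp [tailBlock]
    by_cases hil : i < l
    · rw [if_pos hil]
      unfold kernelMul
      rw [← integral_const_mul]
      congr 1
      funext z
      unfold shearedBlock tailBlock upperBlock upProj
      by_cases hz : a l < z <;> by_cases hx : a i < x <;>
        simp [hl, hil, hz, hx, hR, sub_mul]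
    · simp [shearedBlock, upperBlock, hl, hil]
  rw [← hR] at hchain
  rw [hsum, eq_sub_of_add_eq' hchain]
  unfold shearedBlock tailBlock
  rw [if_pos rfl, ← hR]
  by_cases hi : i = 0
  · subst hi
    unfold scalarKernel
    rw [barChain_eq_barProj, ← hR, chainTail_zero, sub_self, expHK_zero]
    unfold barProj
    by_cases hx : a 0 < x
    · simp [hx, not_le.2 hx]
    · simp [hx, not_lt.1 hx]
  · unfold upProj
    by_cases hx : a i < x <;> simp [hi, hx]

theorem eliminated_col_ne_zero {j : Fin (m + 1)} (hj : j ≠ 0) (p : Fin (m + 1) × ℝ) (y : ℝ) :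
    blockKernel (shearedBlock w a) p (j, y) - blockKernel (tailBlock w a) p (j, y) +
      opMul (matrixMeasure (m + 1)) (blockKernel (shearedBlock w a))
        (blockKernel (tailBlock w a)) p (j, y) = blockKernel (shearedBlock w a) p (j, y) := by
  have h0 : ∀ z, blockKernel (tailBlock w a) z (j, y) = 0 := fun z => by
    simp [blockKernel, tailBlock, hj]
  simp [opMul, h0]

end

theorem measurableEmbedding_mk_zero {m : ℕ} :
    MeasurableEmbedding fun x : ℝ => ((0 : Fin (m + 1)), x) :=
  measurableEmbedding_prodMk_left 0

theorem map_mk_zero_volume {m : ℕ} :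
    (volume : Measure ℝ).map (fun x : ℝ => ((0 : Fin (m + 1)), x)) =
      (matrixMeasure (m + 1)).restrict (Set.range fun x : ℝ => ((0 : Fin (m + 1)), x)) := by
  ext s hs
  have he := measurableEmbedding_mk_zero (m := m)
  rw [Measure.map_apply he.measurable hs, Measure.restrict_apply hs]
  unfold matrixMeasure
  rw [Measure.prod_apply (hs.inter he.measurableSet_range), lintegral_count, tsum_fintype,
    Finset.sum_eq_single 0]
  · congr 1
    ext x
    simp
  · intro i _ hi
    have : Prod.mk i ⁻¹' (s ∩ Set.range fun x : ℝ => ((0 : Fin (m + 1)), x)) = ∅ := by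
      ext x
      simp [Ne.symm hi]
    rw [this, measure_empty]
  · simp

theorem fredholmDet_extendedAiryKernel_eq_scalarKernel {m : ℕ} (w a : Fin (m + 1) → ℝ)
    (hw : StrictMono w) :
    FredholmConverges (matrixMeasure (m + 1)) (extendedAiryKernel w a) ∧
    FredholmConverges volume (scalarKernel w a) ∧
    fredholmDet (matrixMeasure (m + 1)) (extendedAiryKernel w a) =
      fredholmDet volume (scalarKernel w a) := by
  -- a uniform lower bound for the gaps between the `w i`
  obtain ⟨δ, hδ, hδ0⟩ : ∃ δ : ℝ, (∀ i j, i < j → δ ≤ w j - w i) ∧ 0 < δ := by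
    have h1 : ∀ᶠ δ in nhdsWithin (0 : ℝ) (Set.Ioi 0), ∀ i j, i < j → δ ≤ w j - w i :=
      Filter.eventually_all.2 fun i => Filter.eventually_all.2 fun j => by
        by_cases hij : i < j
        · exact (Filter.Eventually.filter_mono nhdsWithin_le_nhds
            (eventually_le_nhds (sub_pos.2 (hw hij)))).mono fun δ h _ => h
        · exact Filter.Eventually.of_forall fun δ h => absurd h hij
    exact (h1.and self_mem_nhdsWithin).exists
  have hφψ := isWeightPair_rowWeight_colWeight a hδ0
  obtain ⟨C₀, hC₀, hext⟩ := exists_isDominated_extendedAiryKernel a hw hδ hδ0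
  obtain ⟨C₁, hC₁, hk₁⟩ := exists_isDominated_extendedBlock a hw hδ hδ0
  obtain ⟨C₂, hC₂, hN₁⟩ := exists_isDominated_shearBlock a hδ hδ0
  obtain ⟨C₃, hC₃, hN₂⟩ := exists_isDominated_tailBlock (δ := δ) a hw
  have hshear := blockKernel_shearedBlock_eq a hw hφψ hk₁ hN₁
  have hk₂ := (hk₁.sub hN₁).add (hk₁.opMul hφψ hN₁)
  rw [hshear] at hk₂
  set C₄ := C₁ + C₂ + C₁ * C₂ * ∫ z, rowWeight a z * colWeight δ z
    ∂(matrixMeasure (m + 1)) with hC₄def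
  have hC₄ : 0 ≤ C₄ := add_nonneg (add_nonneg hC₁ hC₂)
    (mul_nonneg (mul_nonneg hC₁ hC₂) hφψ.integral_nonneg)
  have hk₃ := (hk₂.sub hN₂).add (hk₂.opMul hφψ hN₂)
  set k₃ : Fin (m + 1) × ℝ → Fin (m + 1) × ℝ → ℝ := fun p q =>
    blockKernel (shearedBlock w a) p q -
      blockKernel (tailBlock w a) p q +
      opMul (matrixMeasure (m + 1)) (blockKernel
        (shearedBlock w a)) (blockKernel (tailBlock w a)) p q with hk₃def
  have hk₃0 : ∀ i x y, k₃ (i, x) (0, y) = if i = 0 then scalarKernel w a x y else 0 :=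
    fun i x y => eliminated_col_zero a hw hφψ hk₂ hN₂ i x y
  have hscalar : (fun s t => k₃ (0, s) (0, t)) = scalarKernel w a := by
    funext s t
    rw [hk₃0, if_pos rfl]
  refine ⟨hext.fredholmConverges hφψ hC₀, ?_, ?_⟩
  · -- the scalar kernel is a diagonal block of a dominated kernel
    obtain ⟨D, hD, hdom⟩ : ∃ D, 0 ≤ D ∧ IsDominated (fun x : ℝ => Real.exp (-(2 * |x|)))
        (fun x => Real.exp (-x)) D (scalarKernel w a) := by
      rw [← hscalar]
      exact ⟨_, add_nonneg (add_nonneg hC₄ hC₃)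
        (mul_nonneg (mul_nonneg hC₄ hC₃) hφψ.integral_nonneg),
        hk₃.measurable.comp (by fun_prop : Measurable fun p : ℝ × ℝ =>
          (((0 : Fin (m + 1)), p.1), ((0 : Fin (m + 1)), p.2))), fun s t => by
          simpa [rowWeight, colWeight] using hk₃.bound (0, s) (0, t)⟩
    have hpair : IsWeightPair volume
        (fun x : ℝ => Real.exp (-(2 * |x|))) (fun x => Real.exp (-x)) :=
      ⟨fun _ => (Real.exp_pos _).le, fun _ => (Real.exp_pos _).le,
        integrable_rowWeight_mul_colWeight_zero⟩
    exact hdom.fredholmConverges hpair hD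
  · rw [fredholmDet_extendedAiryKernel_eq a hw]
    have step1 := fredholmDet_column_operation (Y := {p | p.1 = 0}) hφψ
      (hk₁.mono hφψ (le_add_of_nonneg_right hC₂)) (hN₁.mono hφψ (le_add_of_nonneg_left hC₁))
      (fun p q h => by
        have h1 : p.1 = 0 := by
          by_contra hp
          exact h (if_neg fun h' => hp h'.1)
        refine ⟨h1, fun hq => h ?_⟩
        have hq' : q.1 = 0 := hq
        simp [blockKernel, shearBlock, upperBlock, hq'])
    have step2 := fredholmDet_column_operation (Y := {p | p.1 ≠ 0}) hφψ
      (hk₂.mono hφψ (le_add_of_nonneg_right hC₃)) (hN₂.mono hφψ (le_add_of_nonneg_left hC₄))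
      (fun p q h => by
        by_contra hc
        refine h (if_neg fun h' => hc ⟨h'.1, fun hq => hq h'.2⟩))
    rw [hshear] at step1
    rw [← step1, ← step2, ← hscalar]
    -- the row of a point in the last occupied block other than block `0` vanishes
    refine fredholmDet_comp_of_minor_eq_zero measurableEmbedding_mk_zero
      map_mk_zero_volume hk₃.measurable fun n x hx => ?_
    obtain ⟨i₀, hi₀⟩ := hx
    have hi₀' : (x i₀).1 ≠ 0 := fun h => hi₀ ⟨(x i₀).2, Prod.ext h.symm rfl⟩
    have : Nonempty (Fin n) := ⟨i₀⟩
    obtain ⟨i, hi⟩ := Finite.exists_max fun i => (x i).1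
    have hi' : (x i).1 ≠ 0 := ((Fin.pos_iff_ne_zero.2 hi₀').trans_le (hi i₀)).ne'
    refine fredholmMinor_eq_zero_of_row i fun j => ?_
    by_cases hj : (x j).1 = 0
    · have h1 := hk₃0 (x i).1 (x i).2 (x j).2
      rw [if_neg hi', ← hj] at h1
      exact h1
    · refine (eliminated_col_ne_zero a hj (x i) (x j).2).trans ?_
      simp [blockKernel, shearedBlock, upperBlock, hj,
        not_lt.2 (hi j)]

end AiryProc

end

theorem mainTheorem1 (m : ℕ) (w a : Fin (m + 1) → ℝ) (hw : StrictMono w) :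
    (∀ x y s : ℝ, 0 ≤ s →
      MeasureTheory.Integrable (AiryProc.spectralIntegrand (AiryProc.expNegSymbol s) x y)) ∧
    (∀ x y s : ℝ, s < 0 →
      MeasureTheory.Integrable (AiryProc.spectralIntegrand (AiryProc.expSymbol s) x y) ∧
      MeasureTheory.Integrable (AiryProc.spectralIntegrand (AiryProc.expPosSymbol s) x y)) ∧
    AiryProc.BarChainConverges (AiryProc.expHK (w (Fin.last m) - w 0)) m w a ∧
    AiryProc.FredholmConverges (AiryProc.matrixMeasure (m + 1))
      (AiryProc.extendedAiryKernel w a) ∧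
    AiryProc.FredholmConverges MeasureTheory.volume (AiryProc.scalarKernel w a) ∧
    AiryProc.fredholmDet (AiryProc.matrixMeasure (m + 1)) (AiryProc.extendedAiryKernel w a) =
      AiryProc.fredholmDet MeasureTheory.volume (AiryProc.scalarKernel w a) := by
  refine ⟨fun x y s _ =>
    (AiryProc.isAdmissibleSymbol_expNegSymbol s).integrable_spectralIntegrand x y,
    fun x y s hs => ?_, AiryProc.barChainConverges (AiryProc.hasExpBound_expHK
      (sub_nonneg.2 (hw.monotone (Fin.zero_le _)))) m w a hw,
    AiryProc.fredholmDet_extendedAiryKernel_eq_scalarKernel w a hw⟩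
  have hs' := neg_pos.2 hs
  have h1 := (AiryProc.isAdmissibleSymbol_expSymbol hs').integrable_spectralIntegrand x y
  have h2 := AiryProc.integrable_expPosSymbol hs' x y
  rw [neg_neg] at h1 h2
  exact ⟨h1, h2⟩
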